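/- Let $q\ge 2$ and let $\Sigma=\Sigma_q$ be the closed orientable (hyperbolic) surface of genus $q$, with fundamental group $$\pi_1(\Sigma)=\langle a_1,b_1,\dots,a_q,b_q \mid [a_1,b_1][a_2,b_2]\cdots[a_q,b_q]=1\rangle,\qquad [a,b]=aba^{-1}b^{-1}.$$ Let $M$ be either the line $\mathbb{R}$ or the circle $S^1=\mathbb{R}/\mathbb{Z}$, and let $\mathrm{Homeo}_+(M)$ be the group of orientation preserving homeomorphisms of $M$, with the compact-open topology. Let $\mathrm{Rep}(\pi_1(\Sigma),\mathrm{Homeo}_+(M))$ be the set of group homomorphisms $\pi_1(\Sigma)\to \mathrm{Homeo}_+(M)$, with the topology of pointwise convergence (that is, $\rho_n\to\rho$ if and only if $\rho_n(g)\to\rho(g)$ in $\mathrm{Homeo}_+(M)$ for every $g\in\pi_1(\Sigma)$). Then for every $\rho\in \mathrm{Rep}(\pi_1(\Sigma),\mathrm{Homeo}_+(M))$ and every neighbourhood $U$ of $\rho$ there exists $\rho'\in U$ without global fixed points, i.e. such that no $x\in M$ satisfies $\rho'(g)(x)=x$ for all $g\in\pi_1(\Sigma)$. -/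

import Mathlib

open Topology

/-- The standard relator `[a₁,b₁][a₂,b₂]⋯[a_q,b_q]` in the free group on
`a₁, …, a_q` (the generators `Sum.inl i`) and `b₁, …, b_q` (the generators `Sum.inr i`).
The commutator is `[a, b] = a * b * a⁻¹ * b⁻¹`. -/
def surfaceRelator (q : ℕ) : FreeGroup (Fin q ⊕ Fin q) :=
  let a : Fin q → FreeGroup (Fin q ⊕ Fin q) := fun i => FreeGroup.of (Sum.inl i)
  let b : Fin q → FreeGroup (Fin q ⊕ Fin q) := fun i => FreeGroup.of (Sum.inr i)
  (List.ofFn fun i : Fin q => a i * b i * (a i)⁻¹ * (b i)⁻¹).prod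

/-- The fundamental group `π₁(Σ_q)` of the closed orientable surface of genus `q`, given by
its standard presentation `⟨a₁, b₁, …, a_q, b_q ∣ [a₁,b₁]⋯[a_q,b_q] = 1⟩`. The surface is
hyperbolic exactly when `2 ≤ q`. -/
abbrev SurfaceGroup (q : ℕ) : Type :=
  PresentedGroup ({surfaceRelator q} : Set (FreeGroup (Fin q ⊕ Fin q)))

/-- `Homeo₊(ℝ)`: the group (under composition) of orientation preserving, that is increasing,
homeomorphisms of the line. -/
def HomeoPlusReal : Subgroup (ℝ ≃ₜ ℝ) where
  carrier := {f | StrictMono f}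
  mul_mem' := by
    intro f g hf hg
    exact StrictMono.comp (g := ⇑f) (f := ⇑g) hf hg
  one_mem' := strictMono_id
  inv_mem' := by
    intro f hf x y hxy
    have h : f (f.symm x) < f (f.symm y) := by simpa using hxy
    exact hf.lt_iff_lt.mp h

/-- `Homeo₊(S¹)`, with `S¹ = ℝ/ℤ`: the group (under composition) of orientation preserving
homeomorphisms of the circle, that is, those which lift to an increasing homeomorphism of the
universal cover `ℝ`. -/
def HomeoPlusCircle : Subgroup (UnitAddCircle ≃ₜ UnitAddCircle) where
  carrier := {f | ∃ F ∈ HomeoPlusReal, ∀ x : ℝ, f (x : UnitAddCircle) = (F x : UnitAddCircle)}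
  mul_mem' := by
    rintro f g ⟨F, hF, hf⟩ ⟨G, hG, hg⟩
    refine ⟨F * G, mul_mem hF hG, fun x => ?_⟩
    change f (g (x : UnitAddCircle)) = (F (G x) : UnitAddCircle)
    rw [hg, hf]
  one_mem' := ⟨1, one_mem _, fun _ => rfl⟩
  inv_mem' := by
    rintro f ⟨F, hF, hf⟩
    refine ⟨F⁻¹, inv_mem hF, fun x => ?_⟩
    change f.symm (x : UnitAddCircle) = (F.symm x : UnitAddCircle)
    apply f.injective
    rw [hf]
    simp

/-- The compact-open topology on the homeomorphisms of `M`; subgroups of `M ≃ₜ M` carry the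
subspace topology. -/
instance homeoCompactOpen {M : Type*} [TopologicalSpace M] : TopologicalSpace (M ≃ₜ M) :=
  TopologicalSpace.induced (fun f => (f : C(M, M))) ContinuousMap.compactOpen

/-- The set `Rep(G, H)` of representations of `G` into a group `H` of homeomorphisms of `M`. -/
def HomeoRep {M : Type*} [TopologicalSpace M] (G : Type*) [Group G] (H : Subgroup (M ≃ₜ M)) :=
  G →* H

/-- The topology of pointwise convergence on the space of representations: `ρₙ → ρ` if and only
if `ρₙ(g) → ρ(g)` in the compact-open topology for every `g`. -/
instance HomeoRep.topology {M : Type*} [TopologicalSpace M] (G : Type*) [Group G]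
    (H : Subgroup (M ≃ₜ M)) : TopologicalSpace (HomeoRep G H) :=
  TopologicalSpace.induced (fun (ρ : G →* H) (g : G) => ρ g) Pi.topologicalSpace

/-- The set of global fixed points of a representation. -/
def HomeoRep.globalFix {M : Type*} [TopologicalSpace M] {G : Type*} [Group G]
    {H : Subgroup (M ≃ₜ M)} (ρ : HomeoRep G H) : Set M :=
  let φ : G →* H := ρ
  {x | ∀ g : G, (φ g : M ≃ₜ M) x = x}

/-! ### Building order isomorphisms of the line -/

/-! A representation is a tuple of generators `aᵢ, bᵢ` satisfying the relator, and uniform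
convergence on generators passes to words (`TendstoUniformly.lift_freeGroup`). Compactifying the
line to `[0, 1]`, or cutting the circle at a global fixed point, reduces the problem to tuples of
increasing homeomorphisms of an interval.

The decisive trick (`ApproxOn.trans`) removes a common fixed point `p`. If `b₁` is the identity near
`p`, then `a₁` may be replaced by `a₁ f` for any `f` supported there, because `[a₁ f, b₁] = [a₁,
b₁]`; choosing `f` with `f p ≠ p` moves `p`. If moreover `a₂` moves every other point near `p`, no
new common fixed point appears. So it suffices to reach this situation near both ends of each gap
between common fixed points. On intervals shorter than `ε` any action is an admissible
approximation, so a supremum argument (`approxOn_of_fixed`) crosses the whole interval.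

Preparing an end uses genus at least two. Write the relation as `h k = 1` with `h = [a₁, b₁]` and
`k` the product of `[a₂, b₂]` and the remaining commutators. If `h` moves points arbitrarily close
to the end (`exists_end_of_frequently_ne`), cut at such a point. Beyond it, continue `(a₁, b₁)` and
`(a₂, b₂)` so that `h` and `k` push strictly in opposite directions and then become the identity
(`exists_commutator_mul_gt`, `exists_commutator_mul_lt`). The new `k` and `h⁻¹` agree before the cut
and push the same way after it, hence are conjugate by a map that is the identity there
(`exists_conj_of_eq_germ`); conjugating the second half restores the relation. If `h` is trivial
near the end (`exists_end_of_eventually_eq`), the two halves can be conjugated independently there,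
which leaves enough freedom to separate their fixed points. -/

theorem exists_orderIso_glue (a : ℝ) (f g : ℝ ≃o ℝ) (h : f a = g a) :
    ∃ k : ℝ ≃o ℝ, (∀ y ≤ a, k y = f y) ∧ ∀ y, a ≤ y → k y = g y := by
  have hmono : StrictMono (fun y => if y ≤ a then f y else g y) := by
    intro y z hyz
    dsimp only
    split_ifs with h1 h2 h2
    · exact f.strictMono hyz
    · exact (f.monotone h1).trans_lt (h ▸ g.strictMono (not_le.1 h2))
    · linarith
    · exact g.strictMono hyz
  have hsurj : Function.Surjective (fun y => if y ≤ a then f y else g y) := by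
    intro t
    by_cases ht : t ≤ f a
    · refine ⟨f.symm t, ?_⟩
      have : f.symm t ≤ a := (f.symm_apply_le).2 ht
      simp [this]
    · refine ⟨g.symm t, ?_⟩
      have : ¬ g.symm t ≤ a := by
        rw [g.symm_apply_le, ← h]; exact ht
      simp [this]
  refine ⟨hmono.orderIsoOfSurjective _ hsurj, fun y hy => ?_, fun y hy => ?_⟩
  · simp [hy]
  · rcases hy.eq_or_lt with rfl | hy
    · simp [h]
    · simp [not_le.2 hy]

/-- The affine map of slope `m > 0` sending `a` to `b`. -/
noncomputable def affineIso (a b m : ℝ) (hm : 0 < m) : ℝ ≃o ℝ where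
  toFun t := b + m * (t - a)
  invFun t := a + (t - b) / m
  left_inv t := by field_simp; ring
  right_inv t := by field_simp; ring
  map_rel_iff' := by
    intro s t
    simp [hm]

@[simp] theorem affineIso_apply (a b m : ℝ) (hm : 0 < m) (t : ℝ) :
    affineIso a b m hm t = b + m * (t - a) := rfl

/-- Serves to continue a map past `a` from the value `b`: if `G a < b` the result stays above `G`
beyond `a`, and `K` makes it grow as fast as needed. -/
theorem exists_orderIso_add_linear (a b K : ℝ) (hK : 0 < K) (G : ℝ ≃o ℝ) :
    ∃ k : ℝ ≃o ℝ, ∀ t, k t = b + (G t - G a) + K * (t - a) := by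
  have hmono : StrictMono (fun t => b + (G t - G a) + K * (t - a)) := by
    intro y z hyz
    have h1 := G.strictMono hyz
    have h2 := mul_lt_mul_of_pos_left hyz hK
    dsimp only; linarith
  have hsurj : Function.Surjective (fun t => b + (G t - G a) + K * (t - a)) := by
    refine Continuous.surjective ?_ ?_ ?_
    · have := G.continuous
      fun_prop
    · refine Filter.Tendsto.atTop_add_atTop
        (Filter.tendsto_atTop_add_const_left _ _
          (Filter.tendsto_atTop_add_const_right _ _ G.tendsto_atTop)) ?_
      exact (Filter.tendsto_atTop_add_const_right _ (-a) Filter.tendsto_id).const_mul_atTop hK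
    · refine Filter.Tendsto.atBot_add_atBot
        (Filter.tendsto_atBot_add_const_left _ _
          (Filter.tendsto_atBot_add_const_right _ _ G.tendsto_atBot)) ?_
      exact (Filter.tendsto_atBot_add_const_right _ (-a) Filter.tendsto_id).const_mul_atBot hK
  exact ⟨hmono.orderIsoOfSurjective _ hsurj, fun t => rfl⟩

theorem exists_orderIso_eventually_id (f : ℝ ≃o ℝ) (M : ℝ) :
    ∃ k : ℝ ≃o ℝ, (∀ y ≤ M, k y = f y) ∧ ∃ S, ∀ y ≥ S, k y = y := by
  set P := max M (f M) + 1 with hP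
  have h1 : M < P := by have := le_max_left M (f M); linarith
  have h2 : f M < P := by have := le_max_right M (f M); linarith
  have hm : 0 < (P - f M) / (P - M) := div_pos (by linarith) (by linarith)
  obtain ⟨k1, hk1, hk1'⟩ := exists_orderIso_glue P (affineIso M (f M) _ hm) 1 (by
    have : P - M ≠ 0 := by linarith
    simp; field_simp; ring)
  obtain ⟨k, hk, hk'⟩ := exists_orderIso_glue M f k1 (by rw [hk1 _ h1.le]; simp)
  refine ⟨k, hk, P, fun y hy => ?_⟩
  rw [hk' _ (h1.le.trans hy), hk1' _ hy]; rfl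

/-- Transport `f` along a strictly increasing `ψ` onto an interval, and continue by `g` elsewhere. -/
theorem exists_orderIso_embed {ψ : ℝ → ℝ} (hψ : StrictMono ψ) (hI : (Set.range ψ).OrdConnected)
    (f g : ℝ ≃o ℝ) (hg : ∀ y, g y ∈ Set.range ψ ↔ y ∈ Set.range ψ) :
    ∃ k : ℝ ≃o ℝ, (∀ t, k (ψ t) = ψ (f t)) ∧ ∀ y ∉ Set.range ψ, k y = g y := by
  classical
  let F : ℝ → ℝ := fun y => if h : y ∈ Set.range ψ then ψ (f h.choose) else g y
  have hF1 : ∀ t, F (ψ t) = ψ (f t) := by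
    intro t
    have h : ψ t ∈ Set.range ψ := ⟨t, rfl⟩
    have : h.choose = t := hψ.injective h.choose_spec
    simp only [F, dif_pos h, this]
  have hF2 : ∀ y ∉ Set.range ψ, F y = g y := fun y hy => by simp only [F, dif_neg hy]
  have below : ∀ y ∉ Set.range ψ, ∀ s t, y < ψ s → y < ψ t := by
    intro y hy s t hs
    by_contra ht
    exact hy (hI.out ⟨t, rfl⟩ ⟨s, rfl⟩ ⟨not_lt.1 ht, hs.le⟩)
  have above : ∀ y ∉ Set.range ψ, ∀ s t, ψ s < y → ψ t < y := by
    intro y hy s t hs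
    by_contra ht
    exact hy (hI.out ⟨s, rfl⟩ ⟨t, rfl⟩ ⟨hs.le, not_lt.1 ht⟩)
  have hmono : StrictMono F := by
    intro y z hyz
    by_cases hy : y ∈ Set.range ψ <;> by_cases hz : z ∈ Set.range ψ
    · obtain ⟨s, rfl⟩ := hy
      obtain ⟨t, rfl⟩ := hz
      rw [hF1, hF1]
      exact hψ (f.strictMono (hψ.lt_iff_lt.1 hyz))
    · have hgy := (hg y).2 hy
      obtain ⟨u, hu⟩ := hgy
      obtain ⟨s, rfl⟩ := hy
      rw [hF1, hF2 _ hz]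
      refine above _ (fun h => hz ((hg z).1 h)) u _ ?_
      rw [hu]; exact g.strictMono hyz
    · have hgz := (hg z).2 hz
      obtain ⟨u, hu⟩ := hgz
      obtain ⟨s, rfl⟩ := hz
      rw [hF1, hF2 _ hy]
      refine below _ (fun h => hy ((hg y).1 h)) u _ ?_
      rw [hu]; exact g.strictMono hyz
    · rw [hF2 _ hy, hF2 _ hz]; exact g.strictMono hyz
  have hsurj : Function.Surjective F := by
    intro y
    by_cases hy : y ∈ Set.range ψ
    · obtain ⟨t, rfl⟩ := hy
      exact ⟨ψ (f.symm t), by rw [hF1]; simp⟩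
    · refine ⟨g.symm y, ?_⟩
      rw [hF2 _ (by rw [← hg]; simpa using hy)]; simp
  exact ⟨hmono.orderIsoOfSurjective _ hsurj, hF1, hF2⟩

theorem exists_orderIso_restrict {ψ : ℝ → ℝ} (hψ : StrictMono ψ) (f : ℝ ≃o ℝ)
    (hf : ∀ y, f y ∈ Set.range ψ ↔ y ∈ Set.range ψ) :
    ∃ k : ℝ ≃o ℝ, ∀ t, ψ (k t) = f (ψ t) := by
  choose F hF using fun t => (hf (ψ t)).2 ⟨t, rfl⟩
  have hmono : StrictMono F := by
    intro s t hst
    rw [← hψ.lt_iff_lt, hF, hF]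
    exact f.strictMono (hψ hst)
  have hsurj : Function.Surjective F := by
    intro t
    obtain ⟨s, hs⟩ := (hf (f.symm (ψ t))).1 (by simp)
    exact ⟨s, hψ.injective (by rw [hF, hs]; simp)⟩
  exact ⟨hmono.orderIsoOfSurjective _ hsurj, hF⟩

/-! ### Words in families of bijections -/

/-- A map intertwining two families of bijections on an invariant set intertwines all words. -/
theorem freeGroup_lift_semiconj {ι G H α β : Type*} [Group G] [Group H] [MulAction G α]
    [MulAction H β] (σ : ι → G) (τ : ι → H) (ψ : α → β) (S : Set α)
    (hS : ∀ i, ∀ t, σ i • t ∈ S ↔ t ∈ S) (h : ∀ i, ∀ t ∈ S, ψ (σ i • t) = τ i • ψ t)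
    (w : FreeGroup ι) : ∀ t ∈ S, FreeGroup.lift σ w • t ∈ S ∧
      ψ (FreeGroup.lift σ w • t) = FreeGroup.lift τ w • ψ t := by
  induction w using FreeGroup.induction_on with
  | C1 => intro t ht; simpa using ht
  | of i => intro t ht; simpa [hS] using ⟨ht, h i t ht⟩
  | inv_of i _ =>
    intro t ht
    have h1 : (σ i)⁻¹ • t ∈ S := by rw [← hS i]; simpa using ht
    refine ⟨by simpa using h1, ?_⟩
    have h2 := h i _ h1
    rw [smul_inv_smul] at h2
    simp [h2]
  | mul x y hx hy =>
    intro t ht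
    obtain ⟨h1, h2⟩ := hy t ht
    obtain ⟨h3, h4⟩ := hx _ h1
    simp only [map_mul, mul_smul]
    exact ⟨h3, by rw [h4, h2]⟩

instance orderIsoMulAction : MulAction (ℝ ≃o ℝ) ℝ where
  smul f x := f x
  one_smul _ := rfl
  mul_smul _ _ _ := rfl

theorem orderIso_smul_def (f : ℝ ≃o ℝ) (x : ℝ) : f • x = f x := rfl

theorem lift_semiconj_line {ι : Type*} (σ τ : ι → ℝ ≃o ℝ) (ψ : ℝ → ℝ) (S : Set ℝ)
    (hS : ∀ i, ∀ t, σ i t ∈ S ↔ t ∈ S) (h : ∀ i, ∀ t ∈ S, ψ (σ i t) = τ i (ψ t))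
    (w : FreeGroup ι) : ∀ t ∈ S, FreeGroup.lift σ w t ∈ S ∧
      ψ (FreeGroup.lift σ w t) = FreeGroup.lift τ w (ψ t) :=
  freeGroup_lift_semiconj σ τ ψ S hS h w

theorem lift_apply_eq_self {ι : Type*} (σ : ι → ℝ ≃o ℝ) (y : ℝ) (h : ∀ i, σ i y = y)
    (w : FreeGroup ι) : FreeGroup.lift σ w y = y := by
  have := (lift_semiconj_line σ (1 : ι → ℝ ≃o ℝ) id {y} (fun i t => by
    simp only [Set.mem_singleton_iff]
    constructor
    · intro ht; exact (σ i).injective (ht.trans (h i).symm)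
    · rintro rfl; exact h i) (fun i t ht => by
      rw [Set.mem_singleton_iff] at ht; subst ht; simp [h]) w y rfl).1
  simpa using this

/-- This is where genus at least two enters: two commutators are split off, and the other handles
remain a word about which nothing else is used. -/
theorem lift_surfaceRelator {G : Type*} [Group G] (n : ℕ) (T : Fin (n + 2) ⊕ Fin (n + 2) → G) :
    FreeGroup.lift T (surfaceRelator (n + 2)) =
      T (Sum.inl 0) * T (Sum.inr 0) * (T (Sum.inl 0))⁻¹ * (T (Sum.inr 0))⁻¹ *
        (T (Sum.inl 1) * T (Sum.inr 1) * (T (Sum.inl 1))⁻¹ * (T (Sum.inr 1))⁻¹ *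
        FreeGroup.lift (fun i : Fin n ⊕ Fin n => T (Sum.map (fun j => j.succ.succ)
          (fun j => j.succ.succ) i)) (surfaceRelator n)) := by
  simp [surfaceRelator, List.ofFn_succ, map_list_prod, List.map_ofFn,
    Function.comp_def]

/-! ### Extending a pair of homeomorphisms with a commutator of prescribed sign -/

theorem exists_slope {x X v β : ℝ} (hX : x < X) (hβ : v < β) :
    ∃ m : ℝ, 0 < m ∧ m ≤ 1 ∧ v + m * (X - x) < β := by
  have h1 : 0 < (β - v) / (2 * (X - x)) := div_pos (by linarith) (by linarith)
  refine ⟨min 1 ((β - v) / (2 * (X - x))), lt_min one_pos h1, min_le_left _ _, ?_⟩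
  have h2 : min 1 ((β - v) / (2 * (X - x))) * (X - x) ≤ (β - v) / (2 * (X - x)) * (X - x) :=
    mul_le_mul_of_nonneg_right (min_le_right _ _) (by linarith)
  have h3 : (β - v) / (2 * (X - x)) * (X - x) = (β - v) / 2 := by
    have : X - x ≠ 0 := by linarith
    field_simp
  linarith

/-- The values of `A` and `B` up to `x` are kept and the continuation is free. The aim is to bring
`B'` back below the diagonal. `B'` is made nearly flat after `x`, which bounds the left side of the
inequality, and `A'` is then made steep enough to dominate it. -/
theorem commutator_extend_past_fixed (A B s : ℝ ≃o ℝ) {x y₀ : ℝ} (h0 : y₀ ≤ x) (hA : A y₀ ≤ x)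
    (hB : B y₀ ≤ x) (hmax : A y₀ = x ∨ B y₀ = x) (hs : s (B (A y₀)) < A (B y₀)) (hv : x < B x) :
    ∃ (A' B' : ℝ ≃o ℝ) (x' y' : ℝ), x ≤ x' ∧ y₀ ≤ y' ∧ (∀ y ≤ x, A' y = A y) ∧
      (∀ y ≤ x, B' y = B y) ∧ y' ≤ x' ∧ A' y' ≤ x' ∧ B' y' ≤ x' ∧ (y' = x' ∨ A' y' = x') ∧
      B' x' ≤ x' ∧ ∀ y, y₀ ≤ y → y ≤ y' → s (B' (A' y)) < A' (B' y) := by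
  -- `β` is a ceiling for `B'` on `[x, X]`. When `A y₀ = x` it must be low enough for the inequality
  -- to persist while `A (B y)` is still an old value.
  obtain ⟨β, hβ, hβ1, hβ2⟩ : ∃ β, B x < β ∧ β ≤ B x + 1 ∧ (A y₀ = x → s β ≤ A (B y₀)) := by
    by_cases h : A y₀ = x
    · refine ⟨min (B x + 1) (s.symm (A (B y₀))), lt_min (by linarith) ?_, min_le_left _ _,
        fun _ => ?_⟩
      · rw [h] at hs; rwa [s.lt_symm_apply]
      · rw [← s.le_symm_apply]; exact min_le_right _ _
    · exact ⟨B x + 1, by linarith, le_rfl, fun h' => absurd h' h⟩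
  set X := max (A x) (B x + 1) with hX
  have hXx : x < X := lt_of_lt_of_le (by linarith) (le_max_right _ _)
  obtain ⟨m, hm, -, hmβ⟩ := exists_slope hXx hβ
  obtain ⟨B', hB1, hB2⟩ := exists_orderIso_glue x B (affineIso x (B x) m hm) (by simp)
  have hB'X : B' X < β := by rw [hB2 _ hXx.le]; simpa using hmβ
  have hb : B (B.symm x) = x := B.apply_symm_apply x
  have hbx : B.symm x < x := by rwa [B.symm_apply_lt]
  have hyb : y₀ ≤ B.symm x := by rwa [B.le_symm_apply]
  have reg1 : ∀ y, y₀ ≤ y → y ≤ B.symm x → s (B' (A y)) < A (B y) := by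
    intro y hy1 hy2
    rcases hmax with h | h
    · calc s (B' (A y)) ≤ s (B' X) := s.monotone (B'.monotone
            ((A.monotone (hy2.trans hbx.le)).trans (le_max_left _ _)))
        _ < s β := s.strictMono hB'X
        _ ≤ A (B y₀) := hβ2 h
        _ ≤ A (B y) := A.monotone (B.monotone hy1)
    · have : y = y₀ := le_antisymm (by rw [← h] at hy2; simpa using hy2) hy1
      rw [this, hB1 _ hA]; exact hs
  -- With `t = B' y`, the inequality for `y ≤ x` and `t ≥ x` reads `G t < A' t`.
  set G : ℝ ≃o ℝ := s * B' * A * B'⁻¹ with hG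
  have hGB : ∀ y, G (B' y) = s (B' (A y)) := fun y => by simp [hG]
  have hGx : G x < A x := by
    have := reg1 _ hyb le_rfl
    rwa [← hGB, hB1 _ hbx.le, hb] at this
  have hvx : 0 < B x - x := by linarith
  -- This slope lifts `A' (B x)` above `s (B x + 1)`, which settles all `y ≥ x` at once.
  set K := 1 + |s (B x + 1) - A x| / (B x - x) with hK
  have hK0 : 0 < K := by positivity
  obtain ⟨L, hL⟩ := exists_orderIso_add_linear x (A x) K hK0 G
  obtain ⟨A', hA1, hA2⟩ := exists_orderIso_glue x A L (by rw [hL]; ring)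
  have hA'G : ∀ t, x ≤ t → G t < A' t := by
    intro t ht
    rw [hA2 t ht, hL]
    have := mul_nonneg hK0.le (sub_nonneg.2 ht)
    linarith
  have hA'v : s (B x + 1) ≤ A' (B x) := by
    rw [hA2 _ hv.le, hL]
    have h1 := G.strictMono hv
    have h2 : K * (B x - x) = (B x - x) + |s (B x + 1) - A x| := by rw [hK]; field_simp
    have h3 := le_abs_self (s (B x + 1) - A x)
    linarith
  have hx' : x ≤ B x + 1 := by linarith
  have hB'x' : B' (B x + 1) < B x + 1 :=
    lt_of_le_of_lt (B'.monotone (le_max_right _ _)) (hB'X.trans_le hβ1)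
  refine ⟨A', B', B x + 1, min (B x + 1) (A'.symm (B x + 1)), hx', ?_, hA1, hB1,
    min_le_left _ _, ?_, ?_, ?_, hB'x'.le, ?_⟩
  · refine le_min (h0.trans hx') ?_
    rw [A'.le_symm_apply, hA1 _ h0]; exact hA.trans hx'
  · rw [← A'.le_symm_apply]; exact min_le_right _ _
  · exact (B'.monotone (min_le_left _ _)).trans hB'x'.le
  · rcases min_choice (B x + 1) (A'.symm (B x + 1)) with h | h
    · left; exact h
    · right; rw [h]; simp
  · intro y hy1 hy2
    rcases le_total y (B.symm x) with h | h
    · have hyx := h.trans hbx.le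
      rw [hA1 y hyx, hB1 y hyx, hA1 (B y) (by rwa [← B.le_symm_apply])]
      exact reg1 y hy1 h
    · rcases le_total y x with hyx | hyx
      · rw [hA1 y hyx, ← hGB]
        apply hA'G
        rw [hB1 y hyx]; rwa [B.symm_apply_le] at h
      · calc s (B' (A' y)) ≤ s (B' (B x + 1)) := s.monotone (B'.monotone (by
              rw [← A'.le_symm_apply]; exact hy2.trans (min_le_right _ _)))
          _ < s (B x + 1) := s.strictMono hB'x'
          _ ≤ A' (B x) := hA'v
          _ ≤ A' (B' y) := A'.monotone (by rw [← hB1 x le_rfl]; exact B'.monotone hyx)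

/-- By monotonicity the inequality on all of `[y₀, Y]` follows from its extreme form `s (B' (A' Y))
< A (B y₀)`. Hence `A'` climbs only to a point `u'` just above `A x` however large `Y` is, and `B'`
may rise above the diagonal after `u'` without affecting the left side. -/
theorem commutator_extend_raise (A B s : ℝ ≃o ℝ) {x y₀ : ℝ} (S : ℝ) (h0 : y₀ ≤ x) (hA : A y₀ ≤ x)
    (hB : B y₀ ≤ x) (hmax : y₀ = x ∨ A y₀ = x) (hs : s (B (A y₀)) < A (B y₀)) (hv : B x ≤ x) :
    ∃ (A' B' : ℝ ≃o ℝ) (Y : ℝ), x ≤ Y ∧ S ≤ Y ∧ (∀ y ≤ x, A' y = A y) ∧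
      (∀ y ≤ x, B' y = B y) ∧ Y < B' Y ∧ A' Y ≤ Y ∧
      ∀ y, y₀ ≤ y → y ≤ Y → s (B' (A' y)) < A' (B' y) := by
  set τ := s.symm (A (B y₀)) with hτ
  have hsτ : s τ = A (B y₀) := s.apply_symm_apply _
  obtain ⟨m, hm, hm1, hmu⟩ : ∃ m : ℝ, 0 < m ∧ m ≤ 1 ∧
      ∀ B₀ : ℝ ≃o ℝ, (∀ y ≤ x, B₀ y = B y) → (∀ y, x ≤ y → B₀ y = B x + m * (y - x)) →
        B₀ (A x) < τ := by
    rcases le_or_gt (A x) x with hu | hu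
    · refine ⟨1, one_pos, le_rfl, fun B₀ h1 _ => ?_⟩
      rw [h1 _ hu, hτ, s.lt_symm_apply]
      have : y₀ = x := by
        rcases hmax with h | h
        · exact h
        · exact le_antisymm h0 (A.le_iff_le.1 (hu.trans h.ge))
      rwa [← this]
    · have hAy : A y₀ = x := by
        rcases hmax with h | h
        · rw [h] at hA; linarith
        · exact h
      obtain ⟨m, h1, h2, h3⟩ := exists_slope (v := B x) (β := τ) hu
        (by rw [hτ, s.lt_symm_apply]; rwa [hAy] at hs)
      exact ⟨m, h1, h2, fun B₀ _ h => by rw [h _ hu.le]; exact h3⟩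
  obtain ⟨B₀, hB1, hB2⟩ := exists_orderIso_glue x B (affineIso x (B x) m hm) (by simp)
  have hB₀u := hmu B₀ hB1 (fun y hy => by rw [hB2 y hy]; simp)
  have hu1 : A x < B₀.symm τ := by rwa [B₀.lt_symm_apply]
  obtain ⟨u', hu'1, hu'2⟩ := exists_between hu1
  rw [B₀.lt_symm_apply] at hu'2
  set X := max x u' with hX
  have hxX : x ≤ X := le_max_left _ _
  have hB₀X : B₀ X ≤ X := by
    rw [hB2 X hxX]
    have := mul_le_mul_of_nonneg_right hm1 (sub_nonneg.2 hxX)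
    simp only [affineIso_apply]
    linarith
  set Y := max X S + 1 with hY
  have hXY : X + 1 ≤ Y := by have := le_max_left X S; linarith
  have hSY : S ≤ Y := by have := le_max_right X S; linarith
  have hYX : 0 < Y - X := by linarith
  obtain ⟨B', hB'1, hB'2⟩ := exists_orderIso_glue X B₀
    (affineIso X (B₀ X) ((Y + 1 - B₀ X) / (Y - X)) (div_pos (by linarith) hYX)) (by simp)
  have hxY : 0 < Y - x := by linarith
  obtain ⟨A', hA1, hA2⟩ := exists_orderIso_glue x A
    (affineIso x (A x) ((u' - A x) / (Y - x)) (div_pos (by linarith) hxY)) (by simp)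
  have hA'Y : A' Y = u' := by
    rw [hA2 Y (by linarith)]; simp; field_simp; ring
  have hB'Y : B' Y = Y + 1 := by
    rw [hB'2 Y (by linarith)]; simp; field_simp; ring
  have hB'x : ∀ y ≤ x, B' y = B y := fun y hy => by rw [hB'1 y (hy.trans hxX), hB1 y hy]
  refine ⟨A', B', Y, by linarith, hSY, hA1, hB'x, by linarith, ?_, fun y hy1 hy2 => ?_⟩
  · rw [hA'Y]; have := le_max_right x u'; linarith
  · calc s (B' (A' y)) ≤ s (B' (A' Y)) := s.monotone (B'.monotone (A'.monotone hy2))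
      _ = s (B₀ u') := by rw [hA'Y, hB'1 _ (le_max_right _ _)]
      _ < s τ := s.strictMono hu'2
      _ = A (B y₀) := hsτ
      _ = A' (B' y₀) := by rw [hB'x _ h0, hA1 _ hB]
      _ ≤ A' (B' y) := A'.monotone (B'.monotone hy1)

/-- `B'` leaves `(Y, B Y)` with slope `1 / 2` and meets the diagonal at `N = 2 * B Y - Y`, after
which it is the identity. Meanwhile `A'` has climbed to at least `N` at `B Y` and expands by a
factor of at least two from there on. -/
theorem commutator_extend_terminate (A B s : ℝ ≃o ℝ) {S Y y₀ : ℝ} (hs : ∀ y ≥ S, s y = y)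
    (hSY : S ≤ Y) (hB : B y₀ ≤ Y) (hBY : Y < B Y) (hAY : A Y ≤ Y)
    (h : ∀ y, y₀ ≤ y → y ≤ Y → s (B (A y)) < A (B y)) :
    ∃ (A' B' : ℝ ≃o ℝ) (y₂ : ℝ), Y < y₂ ∧ (∀ y ≤ Y, A' y = A y) ∧ (∀ y ≤ Y, B' y = B y) ∧
      (∀ y, y₀ ≤ y → y < y₂ → s (B' (A' y)) < A' (B' y)) ∧ ∀ y ≥ y₂, B' y = y ∧ y < A' y := by
  have hv : 0 < B Y - Y := by linarith
  set N := 2 * B Y - Y with hN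
  have hYN : Y < N := by linarith
  obtain ⟨B₁, hB₁, hB₁'⟩ := exists_orderIso_glue N (affineIso Y (B Y) (1 / 2) (by norm_num)) 1
    (by simp [hN]; ring)
  obtain ⟨B', hB1, hB2⟩ := exists_orderIso_glue Y B B₁ (by rw [hB₁ _ hYN.le]; simp)
  have hB'N : ∀ y ≥ N, B' y = y := fun y hy => by rw [hB2 y (hYN.le.trans hy), hB₁' y hy]; rfl
  have hB'lt : ∀ y, Y ≤ y → y < N → y < B' y := by
    intro y h1 h2
    rw [hB2 y h1, hB₁ y h2.le, affineIso_apply]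
    linarith
  set G : ℝ ≃o ℝ := s * B' * A * B'⁻¹ with hG
  have hGB : ∀ y, G (B' y) = s (B' (A y)) := fun y => by simp [hG]
  -- The summand `2` gives the expansion; the quotient compensates for the low start `A Y`, so that
  -- `N ≤ A' (B Y)`.
  set K := 2 + (Y - A Y) / (B Y - Y) with hK
  have hK0 : 2 ≤ K := by
    have : 0 ≤ (Y - A Y) / (B Y - Y) := div_nonneg (by linarith) hv.le
    linarith
  have hKv : K * (B Y - Y) = 2 * (B Y - Y) + (Y - A Y) := by rw [hK]; field_simp
  obtain ⟨L, hL⟩ := exists_orderIso_add_linear Y (A Y) K (by linarith) G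
  obtain ⟨A', hA1, hA2⟩ := exists_orderIso_glue Y A L (by rw [hL]; ring)
  have hby : B.symm Y < Y := by rwa [B.symm_apply_lt]
  have hGY : G Y < A Y := by
    have h1 := h (B.symm Y) (by rwa [B.le_symm_apply]) hby.le
    rw [B.apply_symm_apply] at h1
    have h2 := hGB (B.symm Y)
    rw [hB1 _ hby.le, B.apply_symm_apply] at h2
    rw [h2, hB1]
    · exact h1
    · exact (A.monotone hby.le).trans hAY
  have hA'G : ∀ t, Y ≤ t → G t < A' t := by
    intro t ht
    rw [hA2 t ht, hL]
    have := mul_nonneg (by linarith : 0 ≤ K) (sub_nonneg.2 ht)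
    linarith
  have hA'ge : ∀ t, B Y ≤ t → N + 2 * (t - B Y) ≤ A' t := by
    intro t ht
    have hYt : Y ≤ t := by linarith
    rw [hA2 t hYt, hL]
    have h1 := G.monotone hYt
    have h2 := mul_le_mul_of_nonneg_right hK0 (sub_nonneg.2 ht)
    have h3 : K * (t - Y) = K * (B Y - Y) + K * (t - B Y) := by ring
    linarith
  refine ⟨A', B', N, hYN, hA1, hB1, fun y hy1 hy2 => ?_, fun y hy => ⟨hB'N y hy, ?_⟩⟩
  · rcases le_total y Y with hyY | hyY
    · rcases le_total (B y) Y with hBy | hBy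
      · rw [hA1 y hyY, hB1 y hyY, hA1 _ hBy, hB1 _ ((A.monotone hyY).trans hAY)]
        exact h y hy1 hyY
      · rw [hA1 y hyY, ← hGB]
        apply hA'G
        rwa [hB1 y hyY]
    · rcases hyY.eq_or_lt with rfl | hyY'
      · rw [hA1 _ le_rfl, ← hGB]
        apply hA'G
        rw [hB1 _ le_rfl]; exact hBY.le
      have hlt := hB'lt y hyY hy2
      -- Beyond `N` both `B'` and `s` are trivial, so once `A' y ≥ N` only `y < B' y` is needed.
      rcases le_total (A' y) N with hN' | hN'
      · have hBYy : B Y < B' y := by rw [← hB1 Y le_rfl]; exact B'.strictMono hyY'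
        calc s (B' (A' y)) ≤ s (B' N) := s.monotone (B'.monotone hN')
          _ = N := by rw [hB'N N le_rfl, hs]; exact hSY.trans hYN.le
          _ ≤ A' (B Y) := by have := hA'ge (B Y) le_rfl; linarith
          _ < A' (B' y) := A'.strictMono hBYy
      · rw [hB'N _ hN', hs _ ((hSY.trans hYN.le).trans hN')]
        exact A'.strictMono hlt
  · have hy' : N ≤ y := hy
    have := hA'ge y (by linarith)
    linarith

/-- Chains the three continuations; the first one is needed only when `B` is above the diagonal at
`x`. -/
theorem commutator_extend_pos (A B s : ℝ ≃o ℝ) {S x y₀ : ℝ} (hS : ∀ y ≥ S, s y = y)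
    (h0 : y₀ ≤ x) (hA : A y₀ ≤ x) (hB : B y₀ ≤ x) (hmax : y₀ = x ∨ A y₀ = x ∨ B y₀ = x)
    (hs : s (B (A y₀)) < A (B y₀)) :
    ∃ (A' B' : ℝ ≃o ℝ) (y₂ : ℝ), S ≤ y₂ ∧ y₀ < y₂ ∧ (∀ y ≤ x, A' y = A y) ∧
      (∀ y ≤ x, B' y = B y) ∧ (∀ y, y₀ ≤ y → y < y₂ → s (B' (A' y)) < A' (B' y)) ∧
      ∀ y ≥ y₂, B' y = y ∧ y < A' y := by
  obtain ⟨A₁, B₁, x', y', hxx, hyy, hA1, hB1, k0, kA, kB, kmax, kv, kreg⟩ :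
      ∃ (A' B' : ℝ ≃o ℝ) (x' y' : ℝ), x ≤ x' ∧ y₀ ≤ y' ∧ (∀ y ≤ x, A' y = A y) ∧
      (∀ y ≤ x, B' y = B y) ∧ y' ≤ x' ∧ A' y' ≤ x' ∧ B' y' ≤ x' ∧ (y' = x' ∨ A' y' = x') ∧
      B' x' ≤ x' ∧ ∀ y, y₀ ≤ y → y ≤ y' → s (B' (A' y)) < A' (B' y) := by
    rcases le_or_gt (B x) x with hv | hv
    · have hmax' : y₀ = x ∨ A y₀ = x := by
        rcases hmax with h | h | h
        · exact Or.inl h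
        · exact Or.inr h
        · left
          refine le_antisymm h0 ?_
          rw [← B.le_iff_le, h]; exact hv
      refine ⟨A, B, x, y₀, le_rfl, le_rfl, fun _ _ => rfl, fun _ _ => rfl, h0, hA, hB, hmax', hv,
        fun y h1 h2 => ?_⟩
      rw [le_antisymm h2 h1]; exact hs
    · have hmax' : A y₀ = x ∨ B y₀ = x := by
        rcases hmax with h | h
        · rw [h] at hB; linarith
        · exact h
      exact commutator_extend_past_fixed A B s h0 hA hB hmax' hs hv
  obtain ⟨A₂, B₂, Y, hxY, hSY, hA2, hB2, jB, jA, jreg⟩ :=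
    commutator_extend_raise A₁ B₁ s S k0 kA kB kmax (kreg y' hyy le_rfl) kv
  have hreg : ∀ y, y₀ ≤ y → y ≤ Y → s (B₂ (A₂ y)) < A₂ (B₂ y) := by
    intro y h1 h2
    rcases le_total y y' with h | h
    · rw [hA2 _ (h.trans k0), hB2 _ (h.trans k0), hA2 _ ((B₁.monotone h).trans kB),
        hB2 _ ((A₁.monotone h).trans kA)]
      exact kreg y h1 h
    · exact jreg y h h2
  have hB2y : B₂ y₀ ≤ Y := by
    rw [hB2 _ (h0.trans hxx), hB1 _ h0]; linarith
  obtain ⟨A₃, B₃, y₂, hY, hA3, hB3, lreg, lend⟩ :=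
    commutator_extend_terminate A₂ B₂ s hS hSY hB2y jB jA hreg
  refine ⟨A₃, B₃, y₂, hSY.trans hY.le, by linarith, fun y hy => ?_, fun y hy => ?_, lreg, lend⟩
  · rw [hA3 y (by linarith), hA2 y (by linarith), hA1 y hy]
  · rw [hB3 y (by linarith), hB2 y (by linarith), hB1 y hy]

theorem inv_eq_of_agree {f f' : ℝ ≃o ℝ} {x : ℝ} (h : ∀ y ≤ x, f' y = f y) {y : ℝ} (hy : y ≤ f x) :
    f'⁻¹ y = f⁻¹ y := by
  have h1 : f⁻¹ y ≤ x := f.symm_apply_le.2 hy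
  have h2 := h _ h1
  rw [RelIso.apply_inv_self] at h2
  rw [← h2, RelIso.inv_apply_self, h2]

/-- Under the substitution `z = r⁻¹ (B (A y))`, the condition `z < [A, B] r z` becomes `r⁻¹ (B (A
y)) < A (B y)`, which is the inequality of `commutator_extend_pos` with `s = r⁻¹`. Values of `A` and
`B` up to `X` determine everything for `z ≤ z₀`. -/
theorem exists_commutator_mul_gt (A B r : ℝ ≃o ℝ) {S z₀ : ℝ} (hS : ∀ y ≥ S, r y = y)
    (hz : z₀ < (A * B * A⁻¹ * B⁻¹ * r) z₀) :
    ∃ (A' B' : ℝ ≃o ℝ) (b : ℝ), z₀ < b ∧ (∀ y ≤ A⁻¹ (B⁻¹ (r z₀)), A' y = A y) ∧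
      (∀ y, y ≤ A⁻¹ (B⁻¹ (r z₀)) ∨ y ≤ B⁻¹ (r z₀) → B' y = B y) ∧
      (∀ z ≤ z₀, (A' * B' * A'⁻¹ * B'⁻¹ * r) z = (A * B * A⁻¹ * B⁻¹ * r) z) ∧
      (∀ z, z₀ ≤ z → z < b → z < (A' * B' * A'⁻¹ * B'⁻¹ * r) z) ∧
      (∀ z ≥ b, (A' * B' * A'⁻¹ * B'⁻¹ * r) z = z) ∧ (∀ z ≥ b, A' z ≠ z) ∧
      ∃ e, ∀ z ≥ e, B' z = z := by
  set y₀ := A⁻¹ (B⁻¹ (r z₀)) with hy₀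
  have hAy : A y₀ = B⁻¹ (r z₀) := by simp [hy₀]
  have hBAy : B (A y₀) = r z₀ := by simp [hAy]
  have hr : ∀ y ≥ S, r⁻¹ y = y := fun y hy => by
    nth_rw 1 [← hS y hy]; simp
  set X := max y₀ (max (A y₀) (B y₀)) with hX
  have hX1 : y₀ ≤ X := le_max_left _ _
  have hX2 : A y₀ ≤ X := (le_max_left _ _).trans (le_max_right _ _)
  have hX3 : B y₀ ≤ X := (le_max_right _ _).trans (le_max_right _ _)
  have hmax : y₀ = X ∨ A y₀ = X ∨ B y₀ = X := by
    rcases max_choice y₀ (max (A y₀) (B y₀)) with h | h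
    · exact Or.inl h.symm
    · rcases max_choice (A y₀) (B y₀) with h' | h'
      · exact Or.inr (Or.inl (by rw [hX, h, h']))
      · exact Or.inr (Or.inr (by rw [hX, h, h']))
  obtain ⟨A', B', y₂, hSy, hy2, hA', hB', hreg, hend⟩ := commutator_extend_pos A B r⁻¹ hr hX1 hX2
    hX3 hmax (by rw [hBAy]; simpa [← hy₀] using hz)
  have key : ∀ y, (A' * B' * A'⁻¹ * B'⁻¹ * r) (r⁻¹ (B' (A' y))) = A' (B' y) := by
    intro y; simp
  have hz0 : r⁻¹ (B' (A' y₀)) = z₀ := by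
    rw [hA' _ hX1, hB' _ hX2, hBAy]; simp
  have hrep : ∀ z, ∃ y, z = r⁻¹ (B' (A' y)) := fun z => ⟨A'⁻¹ (B'⁻¹ (r z)), by simp⟩
  have hmono : StrictMono fun y => r⁻¹ (B' (A' y)) :=
    r⁻¹.strictMono.comp (B'.strictMono.comp A'.strictMono)
  have hlate : ∀ y ≥ y₂, r⁻¹ (B' (A' y)) = A' y ∧ B' y = y ∧ y < A' y := by
    intro y hy
    obtain ⟨h1, h2⟩ := hend y hy
    have h3 : y₂ ≤ A' y := hy.le.trans h2.le
    exact ⟨by rw [(hend _ h3).1, hr _ (hSy.trans h3)], h1, h2⟩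
  refine ⟨A', B', r⁻¹ (B' (A' y₂)), ?_, fun y hy => hA' y (hy.trans hX1),
    fun y hy => hB' y (hy.elim (fun h => h.trans hX1) fun h => (h.trans hAy.ge).trans hX2), fun z hz => ?_, fun z h1 h2 => ?_, fun z hz => ?_,
    fun z hz => ?_, y₂, fun z hz => (hend z hz).1⟩
  · rw [← hz0]; exact hmono hy2
  · have h1 : r z ≤ B (A y₀) := by rw [hBAy]; exact r.monotone hz
    have h2 : B'⁻¹ (r z) = B⁻¹ (r z) := inv_eq_of_agree hB' (h1.trans (B.monotone hX2))
    have h3 : B⁻¹ (r z) ≤ A y₀ := B.symm_apply_le.2 h1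
    have h4 : A'⁻¹ (B⁻¹ (r z)) = A⁻¹ (B⁻¹ (r z)) := inv_eq_of_agree hA' (h3.trans (A.monotone hX1))
    have h5 : A⁻¹ (B⁻¹ (r z)) ≤ y₀ := A.symm_apply_le.2 h3
    simp only [RelIso.mul_apply]
    rw [h2, h4, hB' _ (h5.trans hX1), hA' _ ((B.monotone h5).trans hX3)]
  · obtain ⟨y, rfl⟩ := hrep z
    rw [key]
    rw [← hz0] at h1
    exact hreg y (hmono.le_iff_le.1 h1) (hmono.lt_iff_lt.1 h2)
  · obtain ⟨y, rfl⟩ := hrep z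
    obtain ⟨h1, h2, -⟩ := hlate y (hmono.le_iff_le.1 hz)
    rw [key, h1, h2]
  · obtain ⟨y, rfl⟩ := hrep z
    have hy : y₂ ≤ y := hmono.le_iff_le.1 hz
    obtain ⟨h1, -, h2⟩ := hlate y hy
    rw [h1]
    exact (hend _ (hy.trans h2.le)).2.ne'

/-- The opposite sign leads to the same inequality: with `D = A⁻¹`, `E = r⁻¹ * B` and `z = E t`, the
condition `[A, B] r z < z` becomes `r (E (D t)) < D (E t)`. -/
theorem exists_commutator_mul_lt (A B r : ℝ ≃o ℝ) {S z₀ : ℝ} (hS : ∀ y ≥ S, r y = y)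
    (hz : (A * B * A⁻¹ * B⁻¹ * r) z₀ < z₀) :
    ∃ (A' B' : ℝ ≃o ℝ) (b : ℝ), z₀ < b ∧ (∀ y ≤ A⁻¹ (B⁻¹ (r z₀)), A' y = A y) ∧
      (∀ y, y ≤ A⁻¹ (B⁻¹ (r z₀)) ∨ y ≤ B⁻¹ (r z₀) → B' y = B y) ∧
      (∀ z ≤ z₀, (A' * B' * A'⁻¹ * B'⁻¹ * r) z = (A * B * A⁻¹ * B⁻¹ * r) z) ∧
      (∀ z, z₀ ≤ z → z < b → (A' * B' * A'⁻¹ * B'⁻¹ * r) z < z) ∧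
      (∀ z ≥ b, (A' * B' * A'⁻¹ * B'⁻¹ * r) z = z) ∧ (∀ z ≥ b, A' z ≠ z) ∧
      ∃ e, ∀ z ≥ e, B' z = z := by
  set t₀ := B⁻¹ (r z₀) with ht₀
  set D := A⁻¹ with hD
  set E := r⁻¹ * B with hE
  have hEt : E t₀ = z₀ := by simp [hE, ht₀]
  have hrE : ∀ y, r (E y) = B y := fun y => by simp [hE]
  set X := max t₀ (max (D t₀) (E t₀)) with hX
  have hX1 : t₀ ≤ X := le_max_left _ _
  have hX2 : D t₀ ≤ X := (le_max_left _ _).trans (le_max_right _ _)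
  have hX3 : E t₀ ≤ X := (le_max_right _ _).trans (le_max_right _ _)
  have hmax : t₀ = X ∨ D t₀ = X ∨ E t₀ = X := by
    rcases max_choice t₀ (max (D t₀) (E t₀)) with h | h
    · exact Or.inl h.symm
    · rcases max_choice (D t₀) (E t₀) with h' | h'
      · exact Or.inr (Or.inl (by rw [hX, h, h']))
      · exact Or.inr (Or.inr (by rw [hX, h, h']))
  have hlt : r (E (D t₀)) < D (E t₀) := by
    rw [hrE, hEt, hD]
    change _ < A.symm z₀
    rw [A.lt_symm_apply]
    simpa [ht₀, hD] using hz
  obtain ⟨D', E', t₂, hSt, ht2, hD', hE', hreg, hend⟩ :=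
    commutator_extend_pos D E r hS hX1 hX2 hX3 hmax hlt
  have key : ∀ t, (D'⁻¹ * (r * E') * D'⁻¹⁻¹ * (r * E')⁻¹ * r) (E' t) =
      D'⁻¹ (r (E' (D' t))) := by
    intro t; simp
  have hz0 : E' t₀ = z₀ := by rw [hE' _ hX1, hEt]
  have hE't2 : E' t₂ = t₂ := (hend t₂ le_rfl).1
  have hrep : ∀ z, ∃ t, z = E' t := fun z => ⟨E'⁻¹ z, by simp⟩
  have hAD : ∀ y, D⁻¹ y = A y := fun y => by simp [hD]
  refine ⟨D'⁻¹, r * E', t₂, ?_, fun y hy => ?_, fun y hy => ?_, fun z hz => ?_,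
    fun z h1 h2 => ?_, fun z hz => ?_, fun z hz => ?_, t₂, fun z hz => ?_⟩
  · rw [← hz0, ← hE't2]; exact E'.strictMono ht2
  · rw [inv_eq_of_agree hD' (hy.trans (D.monotone hX1)), hAD]
  · rw [RelIso.mul_apply, hE' y (hy.elim (fun h => h.trans hX2) fun h => h.trans hX1), hrE]
  · have h1 : E'⁻¹ z = E⁻¹ z :=
      inv_eq_of_agree hE' ((hz.trans hEt.ge).trans (E.monotone hX1))
    have h2 : E⁻¹ z ≤ t₀ := E.symm_apply_le.2 (hz.trans hEt.ge)
    have h3 := D.monotone h2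
    have h4 : B (D (E⁻¹ z)) ≤ D X := by
      refine (B.monotone h3).trans ?_
      rw [← hrE]
      exact hlt.le.trans (D.monotone hX3)
    have h5 : D'⁻¹ (B (D (E⁻¹ z))) = D⁻¹ (B (D (E⁻¹ z))) := inv_eq_of_agree hD' h4
    have h6 : (D'⁻¹ * (r * E') * D'⁻¹⁻¹ * (r * E')⁻¹ * r) z = D'⁻¹ (r (E' (D' (E'⁻¹ z)))) := by
      simp
    rw [h6, h1, hD' _ (h2.trans hX1), hE' _ (h3.trans hX2), hrE, h5, hAD]
    simp [hE, hD]
  · obtain ⟨t, rfl⟩ := hrep z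
    rw [key]
    rw [← hz0] at h1
    rw [← hE't2] at h2
    have := hreg t (E'.le_iff_le.1 h1) (E'.lt_iff_lt.1 h2)
    exact D'.symm_apply_lt.2 this
  · obtain ⟨t, rfl⟩ := hrep z
    have ht : t₂ ≤ t := by rw [← E'.le_iff_le, hE't2]; exact hz
    obtain ⟨h1, h2⟩ := hend t ht
    have h3 : t₂ ≤ D' t := ht.trans h2.le
    rw [key, (hend _ h3).1, hS _ (hSt.trans h3), h1]; simp
  · intro h
    have h1 := (hend z hz).2
    have h2 : z = D' z := by nth_rw 2 [← h]; simp
    exact h1.ne h2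
  · rw [RelIso.mul_apply, (hend z hz).1, hS z (hSt.trans hz)]

/-! ### Conjugating homeomorphisms with the same germ -/

/-- A backward orbit that stayed above `a` would decrease to a fixed point of `f` in `[a, b)`. -/
theorem exists_iterate_symm_le {f : ℝ ≃o ℝ} {a b : ℝ} (hf : ∀ y, a ≤ y → y < b → y < f y)
    {y : ℝ} (hy : y < b) : ∃ n : ℕ, f.symm^[n] y ≤ a := by
  by_contra! hcon
  have hstep : ∀ n, f.symm^[n] y < b ∧ f.symm^[n + 1] y ≤ f.symm^[n] y := by
    intro n
    have key : ∀ p, a < p → p < b → f.symm p ≤ p := fun p h1 h2 =>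
      f.symm_apply_le.2 (hf p h1.le h2).le
    have hb : f.symm^[n] y < b := by
      induction n with
      | zero => exact hy
      | succ n ih =>
        rw [Function.iterate_succ_apply']
        exact (key _ (hcon n) ih).trans_lt ih
    refine ⟨hb, ?_⟩
    rw [Function.iterate_succ_apply']
    exact key _ (hcon n) hb
  have hanti : Antitone fun n => f.symm^[n] y := antitone_nat_of_succ_le fun n => (hstep n).2
  have hbdd : BddBelow (Set.range fun n => f.symm^[n] y) :=
    ⟨a, by rintro _ ⟨n, rfl⟩; exact (hcon n).le⟩
  have hlim := tendsto_atTop_ciInf hanti hbdd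
  set L := ⨅ n, f.symm^[n] y
  have hfix : f.symm L = L := isFixedPt_of_tendsto_iterate hlim f.symm.continuous.continuousAt
  have hLa : a ≤ L := le_ciInf fun n => (hcon n).le
  have hLb : L < b := (ciInf_le hbdd 0).trans_lt hy
  have h1 := hf L hLa hLb
  rw [← f.symm_apply_lt, hfix] at h1
  exact h1.false

/-- Below `b` the conjugator is `gⁿ f⁻ⁿ` for any `n` with `f⁻ⁿ y ≤ a`; the choice of `n` is
immaterial because `f` and `g` agree below `a`. From `b` on both maps are trivial and a translation
does. -/
theorem exists_conj_of_eq_germ {f g : ℝ ≃o ℝ} {a b b' : ℝ} (hab : a < b) (hab' : a < b')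
    (hfg : ∀ y ≤ a, f y = g y) (hf : ∀ y, a ≤ y → y < b → y < f y)
    (hg : ∀ y, a ≤ y → y < b' → y < g y) (hfb : ∀ y ≥ b, f y = y) (hgb : ∀ y ≥ b', g y = y) :
    ∃ c : ℝ ≃o ℝ, (∀ y ≤ a, c y = y) ∧ ∀ y, c (f y) = g (c y) := by
  classical
  choose! N hN using fun (y : ℝ) (hy : y < b) => exists_iterate_symm_le hf hy
  choose! N' hN' using fun (y : ℝ) (hy : y < b') => exists_iterate_symm_le hg hy
  have hfa : f.symm a < a := f.symm_apply_lt.2 (hf a le_rfl hab)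
  have hga : g.symm a < a := g.symm_apply_lt.2 (hg a le_rfl hab')
  have stay : ∀ n m y, f.symm^[n] y ≤ a → f.symm^[n + m] y ≤ a ∧
      g^[n + m] (f.symm^[n + m] y) = g^[n] (f.symm^[n] y) := by
    intro n m y h
    induction m with
    | zero => exact ⟨h, rfl⟩
    | succ m ih =>
      have h1 : f.symm (f.symm^[n + m] y) ≤ a := (f.symm.monotone ih.1).trans hfa.le
      rw [← add_assoc, Function.iterate_succ_apply']
      refine ⟨h1, ?_⟩
      rw [Function.iterate_succ_apply, ← hfg _ h1, f.apply_symm_apply]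
      exact ih.2
  have stay' : ∀ n m y, g.symm^[n] y ≤ a → g.symm^[n + m] y ≤ a := by
    intro n m y h
    induction m with
    | zero => exact h
    | succ m ih =>
      rw [← add_assoc, Function.iterate_succ_apply']
      exact (g.symm.monotone ih).trans hga.le
  let F : ℝ → ℝ := fun y => if y < b then g^[N y] (f.symm^[N y] y) else y - b + b'
  have hF : ∀ y < b, ∀ n, f.symm^[n] y ≤ a → F y = g^[n] (f.symm^[n] y) := by
    intro y hy n hn
    simp only [F, if_pos hy]
    rw [← (stay _ n y (hN y hy)).2, ← (stay n (N y) y hn).2, add_comm]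
  have hF' : ∀ y, b ≤ y → F y = y - b + b' := fun y hy => by simp only [F, if_neg (not_lt.2 hy)]
  have gmono : ∀ n, StrictMono g^[n] := fun n => g.strictMono.iterate n
  have glt : ∀ n y, y < b' → g^[n] y < b' := by
    intro n y hy
    have : g^[n] b' = b' := Function.iterate_fixed (hgb b' le_rfl) n
    rw [← this]; exact gmono n hy
  have flt : ∀ n y, y < b → f^[n] y < b := by
    intro n y hy
    have : f^[n] b = b := Function.iterate_fixed (hfb b le_rfl) n
    rw [← this]; exact f.strictMono.iterate n hy
  have hFlt : ∀ y < b, F y < b' := by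
    intro y hy
    rw [hF y hy _ (hN y hy)]
    exact glt _ _ ((hN y hy).trans_lt hab')
  have hmono : StrictMono F := by
    intro y z hyz
    rcases lt_or_ge z b with hz | hz
    · have hy := hyz.trans hz
      rw [hF y hy _ (stay _ (N z) y (hN y hy)).1, hF z hz (N y + N z)
        (by rw [add_comm]; exact (stay _ (N y) z (hN z hz)).1)]
      exact gmono _ (f.symm.strictMono.iterate _ hyz)
    · rw [hF' z hz]
      rcases lt_or_ge y b with hy | hy
      · have := hFlt y hy; linarith
      · rw [hF' y hy]; linarith
  have hsurj : Function.Surjective F := by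
    intro t
    rcases lt_or_ge t b' with ht | ht
    · set n := N' t
      have h1 : g.symm^[n] t ≤ a := hN' t ht
      refine ⟨f^[n] (g.symm^[n] t), ?_⟩
      have h2 : f.symm^[n] (f^[n] (g.symm^[n] t)) = g.symm^[n] t :=
        (Function.LeftInverse.iterate f.left_inv n) _
      rw [hF _ (flt _ _ (h1.trans_lt hab)) n (by rw [h2]; exact h1), h2]
      exact (Function.LeftInverse.iterate g.right_inv n) _
    · exact ⟨t - b' + b, by rw [hF' _ (by linarith)]; ring⟩
  refine ⟨hmono.orderIsoOfSurjective _ hsurj, fun y hy => hF y (hy.trans_lt hab) 0 hy, fun y => ?_⟩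
  change F (f y) = g (F y)
  rcases lt_or_ge y b with hy | hy
  · have h1 : f.symm^[N y + 1] (f y) = f.symm^[N y] y := by
      rw [Function.iterate_succ_apply]; simp
    rw [hF (f y) (flt 1 y hy) (N y + 1) (by rw [h1]; exact hN y hy), h1,
      Function.iterate_succ_apply', hF y hy _ (hN y hy)]
  · rw [hfb y hy, hF' y hy, hgb _ (by linarith)]

/-! ### Words only see generators on a half-line -/

theorem exists_lift_agree {ι : Type*} (σ : ι → ℝ ≃o ℝ) (w : FreeGroup ι) (z : ℝ) :
    ∃ M, ∀ τ : ι → ℝ ≃o ℝ, (∀ i, ∀ y ≤ M, τ i y = σ i y) →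
      ∀ y ≤ z, FreeGroup.lift τ w y = FreeGroup.lift σ w y := by
  induction w using FreeGroup.induction_on generalizing z with
  | C1 => exact ⟨0, fun τ _ y _ => by simp⟩
  | of i => exact ⟨z, fun τ h y hy => by simpa using h i y hy⟩
  | inv_of i _ =>
    refine ⟨(σ i)⁻¹ z, fun τ h y hy => ?_⟩
    simp only [map_inv, FreeGroup.lift_apply_of]
    exact inv_eq_of_agree (h i) (by simpa using hy)
  | mul v w hv hw =>
    obtain ⟨M, hM⟩ := hw z
    obtain ⟨M', hM'⟩ := hv (FreeGroup.lift σ w z)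
    refine ⟨max M M', fun τ h y hy => ?_⟩
    rw [map_mul, map_mul, RelIso.mul_apply, RelIso.mul_apply,
      hM τ (fun i y hy => h i y (hy.trans (le_max_left _ _))) y hy]
    exact hM' τ (fun i y hy => h i y (hy.trans (le_max_right _ _))) _
      ((FreeGroup.lift σ w).monotone hy)

/-! ### Preparing one end of the line -/

/-- Below `q z₀` both `p'` and `q'⁻¹` coincide with `p = q⁻¹`, and above it both push to the right
until they become trivial. The conjugator is the identity on a half-line, so conjugating by it
leaves the old data alone there. -/
theorem exists_conj_of_mul_eq_one {p q p' q' : ℝ ≃o ℝ} {z₀ b b' : ℝ} (hpq : p * q = 1)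
    (hb : z₀ < b) (hb' : z₀ < b') (hp : ∀ z ≤ z₀, p' z = p z) (hq : ∀ z ≤ z₀, q' z = q z)
    (hp1 : ∀ z, z₀ ≤ z → z < b → z < p' z) (hp2 : ∀ z ≥ b, p' z = z)
    (hq1 : ∀ z, z₀ ≤ z → z < b' → q' z < z) (hq2 : ∀ z ≥ b', q' z = z) :
    ∃ c : ℝ ≃o ℝ, (∀ y ≤ q z₀, c y = y) ∧ c * p' * c⁻¹ = q'⁻¹ := by
  have hpq' : ∀ y, p (q y) = y := fun y => by rw [← RelIso.mul_apply, hpq]; rfl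
  have hq0 : q z₀ < z₀ := by rw [← hq _ le_rfl]; exact hq1 _ le_rfl hb'
  have hqinv : ∀ y ≤ q z₀, q'⁻¹ y = p y := by
    intro y hy
    rw [inv_eq_of_agree hq hy]
    have : q⁻¹ = p := inv_eq_of_mul_eq_one_left hpq
    rw [this]
  obtain ⟨c, hc, hcc⟩ := exists_conj_of_eq_germ (f := p') (g := q'⁻¹) (a := q z₀) (b := b) (b' := b')
    (hq0.trans hb) (hq0.trans hb') (fun y hy => by rw [hqinv y hy, hp _ (hy.trans hq0.le)])
    (fun y h1 h2 => by
      rcases le_or_gt z₀ y with h | h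
      · exact hp1 y h h2
      · rw [hp y h.le]
        refine h.trans_le ?_
        rw [← hpq' z₀]; exact p.monotone h1)
    (fun y h1 h2 => by
      obtain ⟨t, rfl⟩ : ∃ t, y = q' t := ⟨q'⁻¹ y, by simp⟩
      rw [RelIso.inv_apply_self]
      refine hq1 t ?_ ?_
      · rwa [← hq _ le_rfl, q'.le_iff_le] at h1
      · rwa [← hq2 b' le_rfl, q'.lt_iff_lt] at h2)
    hp2 (fun y hy => by
      have := hq2 y hy
      nth_rw 1 [← this]; simp)
  refine ⟨c, hc, ?_⟩
  ext y
  simp [hcc]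

/-- The relation is broken by continuing the two halves separately and is then repaired by
conjugating the second half. Common fixed points can only be old ones, because beyond the cut the
new first commutator, and later `A₁'`, has no fixed point. -/
theorem exists_end_of_frequently_ne {ι : Type*} [Finite ι] (A₁ B₁ A₂ B₂ : ℝ ≃o ℝ)
    (C : ι → ℝ ≃o ℝ) (w : FreeGroup ι)
    (hrel : A₁ * B₁ * A₁⁻¹ * B₁⁻¹ * (A₂ * B₂ * A₂⁻¹ * B₂⁻¹ * FreeGroup.lift C w) = 1) (x : ℝ)
    (hne : ∃ᶠ z in Filter.atTop, (A₁ * B₁ * A₁⁻¹ * B₁⁻¹) z ≠ z) :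
    ∃ (A₁' B₁' A₂' B₂' : ℝ ≃o ℝ) (C' : ι → ℝ ≃o ℝ),
      A₁' * B₁' * A₁'⁻¹ * B₁'⁻¹ * (A₂' * B₂' * A₂'⁻¹ * B₂'⁻¹ * FreeGroup.lift C' w) = 1 ∧
      (∀ y ≤ x, A₁' y = A₁ y ∧ B₁' y = B₁ y ∧ A₂' y = A₂ y ∧ B₂' y = B₂ y ∧
        ∀ i, C' i y = C i y) ∧
      (∀ y, A₁' y = y → B₁' y = y → A₂' y = y → B₂' y = y → (∀ i, C' i y = y) →
        A₁ y = y ∧ B₁ y = y ∧ A₂ y = y ∧ B₂ y = y ∧ ∀ i, C i y = y) ∧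
      ∀ᶠ y in Filter.atTop, B₁' y = y ∧ A₂' y ≠ y := by
  set h := A₁ * B₁ * A₁⁻¹ * B₁⁻¹ with hh
  set r := FreeGroup.lift C w with hr
  set k := A₂ * B₂ * A₂⁻¹ * B₂⁻¹ * r with hk
  have hkh : k * h = 1 := mul_eq_one_comm.1 hrel
  have hlarge : ∀ (f : ℝ ≃o ℝ) (v : ℝ), ∀ᶠ z in Filter.atTop, v ≤ f z := fun f v =>
    f.tendsto_atTop.eventually_ge_atTop v
  -- The cut `z₀` lies so far out that the values on `(-∞, x]` survive both the continuation and the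
  -- later conjugation.
  obtain ⟨z₀, hz₀, hx1, hx2, hxa, hya, hA₂a, hB₂a, hCa⟩ := (hne.and_eventually
    ((hlarge (A₁⁻¹ * B₁⁻¹) x).and ((hlarge (A₂⁻¹ * B₂⁻¹ * r) x).and ((Filter.eventually_ge_atTop x).and
    (((hlarge h x).and (hlarge k x)).and (((hlarge h (A₂ x)).and (hlarge k (A₂ x))).and
    (((hlarge h (B₂ x)).and (hlarge k (B₂ x))).and
    (Filter.eventually_all.2 fun i => (hlarge h (C i x)).and (hlarge k (C i x)))))))))).exists
  simp only [RelIso.mul_apply] at hx1 hx2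
  -- make the remaining generators trivial near infinity
  obtain ⟨M, hM⟩ := exists_lift_agree C w z₀
  choose C₁ hC₁ S hS using fun i => exists_orderIso_eventually_id (C i) (max M (max z₀ x))
  obtain ⟨S₀, hS₀⟩ := (Set.finite_range S).bddAbove
  set r' := FreeGroup.lift C₁ w with hr'
  have hr'S : ∀ y ≥ S₀, r' y = y := fun y hy =>
    lift_apply_eq_self C₁ y (fun i => hS i y ((hS₀ ⟨i, rfl⟩).trans hy)) w
  have hr'z : ∀ y ≤ z₀, r' y = r y :=
    hM C₁ fun i y hy => hC₁ i y (hy.trans (le_max_left _ _))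
  have hk'z : ∀ z ≤ z₀, (A₂ * B₂ * A₂⁻¹ * B₂⁻¹ * r') z = k z := fun z hz => by
    simp only [hk, RelIso.mul_apply, hr'z z hz]
  obtain ⟨A₁', B₁', b, A₂', B₂', b', d, a, hb, hA₁, hB₁, hh', hne', hAb, hBe, hA₂, hB₂, hA₂b,
    hd, hconj, ha, hafix⟩ : ∃ (A₁' B₁' : ℝ ≃o ℝ) (b : ℝ) (A₂' B₂' : ℝ ≃o ℝ) (b' : ℝ)
      (d : ℝ ≃o ℝ) (a : ℝ), z₀ < b ∧ (∀ y ≤ A₁⁻¹ (B₁⁻¹ z₀), A₁' y = A₁ y) ∧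
      (∀ y, y ≤ A₁⁻¹ (B₁⁻¹ z₀) ∨ y ≤ B₁⁻¹ z₀ → B₁' y = B₁ y) ∧
      (∀ z ≤ z₀, (A₁' * B₁' * A₁'⁻¹ * B₁'⁻¹) z = h z) ∧
      (∀ z, z₀ ≤ z → z < b → (A₁' * B₁' * A₁'⁻¹ * B₁'⁻¹) z ≠ z) ∧ (∀ z ≥ b, A₁' z ≠ z) ∧
      (∃ e, ∀ z ≥ e, B₁' z = z) ∧
      (∀ y ≤ A₂⁻¹ (B₂⁻¹ (r z₀)), A₂' y = A₂ y) ∧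
      (∀ y, y ≤ A₂⁻¹ (B₂⁻¹ (r z₀)) ∨ y ≤ B₂⁻¹ (r z₀) → B₂' y = B₂ y) ∧
      (∀ z ≥ b', A₂' z ≠ z) ∧ (∀ y ≤ a, d y = y) ∧
      d * (A₂' * B₂' * A₂'⁻¹ * B₂'⁻¹ * r') * d⁻¹ = (A₁' * B₁' * A₁'⁻¹ * B₁'⁻¹)⁻¹ ∧
      (a = h z₀ ∨ a = k z₀) ∧ ∀ y ≤ z₀, h y = y → y ≤ a := by
    have hkh' : ∀ y, k (h y) = y := fun y => by rw [← RelIso.mul_apply, hkh]; rfl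
    have hhk' : ∀ y, h (k y) = y := fun y => by rw [← RelIso.mul_apply, hrel]; rfl
    -- Since `k h = 1`, the sign of `h` at `z₀` forces the opposite sign of `k`.
    rcases hz₀.lt_or_gt with hlt | hgt
    · obtain ⟨A₁', B₁', b, hb, h1, h2, h3, h4, h5, h6, h7⟩ :=
        exists_commutator_mul_lt A₁ B₁ 1 (S := 0) (fun _ _ => rfl) (z₀ := z₀) (by rw [mul_one]; exact hlt)
      obtain ⟨A₂', B₂', b', hb', i1, i2, i3, i4, i5, i6, i7⟩ :=
        exists_commutator_mul_gt A₂ B₂ r' (z₀ := z₀) hr'S (by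
          rw [hk'z _ le_rfl]
          nth_rw 1 [← hkh' z₀]
          exact k.strictMono hlt)
      simp only [mul_one, RelIso.coe_one, id, hr'z z₀ le_rfl] at h1 h2 h3 h4 h5 i1 i2
      obtain ⟨c, hc, hcc⟩ := exists_conj_of_mul_eq_one hkh hb' hb
        (fun z hz => (i3 z hz).trans (hk'z z hz)) h3 i4 i5 h4 h5
      refine ⟨A₁', B₁', b, A₂', B₂', b', c, h z₀, hb, h1, h2, h3,
        fun z hz hz' => (h4 z hz hz').ne, h6, h7, i1, i2, i6, hc, hcc, Or.inl rfl,
        fun y hy hy' => ?_⟩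
      rw [← hy']; exact h.monotone hy
    · obtain ⟨A₁', B₁', b, hb, h1, h2, h3, h4, h5, h6, h7⟩ :=
        exists_commutator_mul_gt A₁ B₁ 1 (S := 0) (fun _ _ => rfl) (z₀ := z₀) (by rw [mul_one]; exact hgt)
      obtain ⟨A₂', B₂', b', hb', i1, i2, i3, i4, i5, i6, i7⟩ :=
        exists_commutator_mul_lt A₂ B₂ r' (z₀ := z₀) hr'S (by
          rw [hk'z _ le_rfl]
          nth_rw 2 [← hkh' z₀]
          exact k.strictMono hgt)
      simp only [mul_one, RelIso.coe_one, id, hr'z z₀ le_rfl] at h1 h2 h3 h4 h5 i1 i2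
      obtain ⟨c, hc, hcc⟩ := exists_conj_of_mul_eq_one hrel hb hb' h3
        (fun z hz => (i3 z hz).trans (hk'z z hz)) h4 h5 i4 i5
      refine ⟨A₁', B₁', b, A₂', B₂', b', c⁻¹, k z₀, hb, h1, h2, h3,
        fun z hz hz' => (h4 z hz hz').ne', h6, h7, i1, i2, i6, fun y hy => ?_, ?_, Or.inr rfl,
        fun y hy hy' => ?_⟩
      · nth_rw 1 [← hc y hy]; simp
      · rw [← inv_inv (A₂' * B₂' * A₂'⁻¹ * B₂'⁻¹ * r'), ← hcc]; group
      · have : k y = y := by nth_rw 1 [← hy']; exact hkh' y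
        rw [← this]; exact k.monotone hy
  have hda : ∀ y ≤ a, d⁻¹ y = y := fun y hy => by nth_rw 1 [← hd y hy]; simp
  have hax : x ≤ a := by rcases ha with rfl | rfl; exacts [hya.1, hya.2]
  have hconj_apply : ∀ (f : ℝ ≃o ℝ) y, y ≤ x → f x ≤ a → (d * f * d⁻¹) y = f y := by
    intro f y hy hf
    simp only [RelIso.mul_apply]
    rw [hda y (hy.trans hax), hd _ ((f.monotone hy).trans hf)]
  have hconj_fix : ∀ (f : ℝ ≃o ℝ) y, y ≤ a → (d * f * d⁻¹) y = y → f y = y := by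
    intro f y hy hf
    simp only [RelIso.mul_apply] at hf
    rw [hda y hy] at hf
    have := congrArg (d⁻¹ : ℝ ≃o ℝ) hf
    rwa [RelIso.inv_apply_self, hda y hy] at this
  have hlift : FreeGroup.lift (fun i => d * C₁ i * d⁻¹) w = d * r' * d⁻¹ := by
    have : FreeGroup.lift (fun i => d * C₁ i * d⁻¹) =
        (MulAut.conj d).toMonoidHom.comp (FreeGroup.lift C₁) := by
      ext i; simp
    rw [this]; simp [hr']
  refine ⟨A₁', B₁', d * A₂' * d⁻¹, d * B₂' * d⁻¹, fun i => d * C₁ i * d⁻¹, ?_, fun y hy => ?_,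
    fun y f1 f2 f3 f4 f5 => ?_, ?_⟩
  · rw [hlift, mul_eq_one_iff_eq_inv', ← inv_inv (A₁' * B₁' * A₁'⁻¹ * B₁'⁻¹), ← hconj]
    group
  · refine ⟨hA₁ y (hy.trans hx1), hB₁ y (Or.inl (hy.trans hx1)), ?_, ?_, fun i => ?_⟩
    · rw [hconj_apply _ y hy, hA₂ y (hy.trans hx2)]
      rw [hA₂ x hx2]; rcases ha with rfl | rfl; exacts [hA₂a.1, hA₂a.2]
    · rw [hconj_apply _ y hy, hB₂ y (Or.inl (hy.trans hx2))]
      rw [hB₂ x (Or.inl hx2)]; rcases ha with rfl | rfl; exacts [hB₂a.1, hB₂a.2]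
    · have hC : ∀ y ≤ x, C₁ i y = C i y := fun y hy =>
        hC₁ i y (hy.trans ((le_max_right _ _).trans (le_max_right _ _)))
      rw [hconj_apply _ y hy, hC y hy]
      rw [hC x le_rfl]; rcases ha with rfl | rfl; exacts [(hCa i).1, (hCa i).2]
  · have inv_fix : ∀ f : ℝ ≃o ℝ, f y = y → f⁻¹ y = y := fun f hf => by
      nth_rw 1 [← hf]; simp
    have hh'y : (A₁' * B₁' * A₁'⁻¹ * B₁'⁻¹) y = y := by
      simp only [RelIso.mul_apply]
      rw [inv_fix _ f2, inv_fix _ f1, f2, f1]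
    have hyz : y ≤ z₀ := by
      by_contra hcon
      rcases lt_or_ge y b with h' | h'
      · exact hne' y (le_of_not_ge hcon) h' hh'y
      · exact hAb y h' f1
    have hya : y ≤ a := hafix y hyz (by rw [← hh' y hyz]; exact hh'y)
    have g3 := hconj_fix _ y hya f3
    have g4 := hconj_fix _ y hya f4
    have g5 : ∀ i, C i y = y := fun i => by
      rw [← hC₁ i y (hyz.trans ((le_max_left _ _).trans (le_max_right _ _)))]
      exact hconj_fix _ y hya (f5 i)
    have hry : r y = y := lift_apply_eq_self C y g5 w
    -- A common fixed point before `z₀` also lies before the preimages of `z₀`, where the new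
    -- generators equal the old ones.
    have hy0 : y ≤ A₁⁻¹ (B₁⁻¹ z₀) := by
      have e1 : B₁' (A₁' (A₁⁻¹ (B₁⁻¹ z₀))) = z₀ := by
        rw [hA₁ _ le_rfl, RelIso.apply_inv_self, hB₁ _ (Or.inr le_rfl), RelIso.apply_inv_self]
      rw [← A₁'.le_iff_le, ← B₁'.le_iff_le, e1, f1, f2]
      exact hyz
    have hy0' : y ≤ A₂⁻¹ (B₂⁻¹ (r z₀)) := by
      have e1 : B₂' (A₂' (A₂⁻¹ (B₂⁻¹ (r z₀)))) = r z₀ := by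
        rw [hA₂ _ le_rfl, RelIso.apply_inv_self, hB₂ _ (Or.inr le_rfl), RelIso.apply_inv_self]
      rw [← A₂'.le_iff_le, ← B₂'.le_iff_le, e1, g3, g4, ← hry]
      exact r.monotone hyz
    exact ⟨by rw [← hA₁ y hy0]; exact f1, by rw [← hB₁ y (Or.inl hy0)]; exact f2,
      by rw [← hA₂ y hy0']; exact g3, by rw [← hB₂ y (Or.inl hy0')]; exact g4, g5⟩
  · obtain ⟨e, he⟩ := hBe
    filter_upwards [Filter.eventually_ge_atTop e, hlarge d⁻¹ b'] with y h1 h2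
    refine ⟨he y h1, fun h3 => hA₂b _ h2 ?_⟩
    simp only [RelIso.mul_apply] at h3
    have := congrArg (d⁻¹ : ℝ ≃o ℝ) h3
    rwa [RelIso.inv_apply_self] at this

theorem exists_squeeze (m : ℝ) : ∃ ψ : ℝ → ℝ, StrictMono ψ ∧ (∀ t ≤ m, ψ t = t) ∧
    Set.range ψ = Set.Iio (m + 1) := by
  have hmono : StrictMono fun t => if t ≤ m then t else m + (t - m) / (1 + (t - m)) := by
    intro s t hst
    dsimp only
    split_ifs with h1 h2 h2
    · exact hst
    · have : 0 < (t - m) / (1 + (t - m)) := div_pos (by linarith) (by linarith)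
      linarith
    · linarith
    · have h3 : (s - m) / (1 + (s - m)) < (t - m) / (1 + (t - m)) := by
        rw [div_lt_div_iff₀ (by linarith) (by linarith)]
        nlinarith
      linarith
  refine ⟨_, hmono, fun t ht => if_pos ht, Set.Subset.antisymm ?_ ?_⟩
  · rintro _ ⟨t, rfl⟩
    simp only [Set.mem_Iio]
    split_ifs with h
    · linarith
    · have : (t - m) / (1 + (t - m)) < 1 := by rw [div_lt_one (by linarith)]; linarith
      linarith
  · intro y hy
    rw [Set.mem_Iio] at hy
    rcases le_or_gt y m with h | h
    · exact ⟨y, if_pos h⟩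
    · have h1 : 0 < m + 1 - y := by linarith
      have h2 : 0 < (y - m) / (m + 1 - y) := div_pos (by linarith) h1
      refine ⟨m + (y - m) / (m + 1 - y), ?_⟩
      simp only
      rw [if_neg (by linarith)]
      have : m + (y - m) / (m + 1 - y) - m = (y - m) / (m + 1 - y) := by ring
      rw [this]
      have h3 : 1 + (y - m) / (m + 1 - y) = 1 / (m + 1 - y) := by field_simp; ring
      rw [h3]
      field_simp
      ring

/-- The old action is squeezed into `(-∞, m + 1)`; on the rest `a₁` and `a₂` expand and all other
generators are trivial. The first commutator is then trivial from `m` on, so each half can be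
conjugated separately by a map supported in `[m, ∞)` without harming the relation. This freedom is
used to remove the new common fixed point `m + 1` and any other beyond `m`. -/
theorem exists_end_of_eventually_eq {ι : Type*} [Finite ι] (A₁ B₁ A₂ B₂ : ℝ ≃o ℝ)
    (C : ι → ℝ ≃o ℝ) (w : FreeGroup ι)
    (hrel : A₁ * B₁ * A₁⁻¹ * B₁⁻¹ * (A₂ * B₂ * A₂⁻¹ * B₂⁻¹ * FreeGroup.lift C w) = 1) (x : ℝ)
    (heq : ∀ᶠ z in Filter.atTop, (A₁ * B₁ * A₁⁻¹ * B₁⁻¹) z = z)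
    (hfix : ∀ y, A₁ y = y → B₁ y = y → A₂ y = y → B₂ y = y → ¬ ∀ i, C i y = y) :
    ∃ (A₁' B₁' A₂' B₂' : ℝ ≃o ℝ) (C' : ι → ℝ ≃o ℝ),
      A₁' * B₁' * A₁'⁻¹ * B₁'⁻¹ * (A₂' * B₂' * A₂'⁻¹ * B₂'⁻¹ * FreeGroup.lift C' w) = 1 ∧
      (∀ y ≤ x, A₁' y = A₁ y ∧ B₁' y = B₁ y ∧ A₂' y = A₂ y ∧ B₂' y = B₂ y ∧
        ∀ i, C' i y = C i y) ∧
      (∀ y, A₁' y = y → B₁' y = y → A₂' y = y → B₂' y = y → ¬ ∀ i, C' i y = y) ∧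
      ∀ᶠ y in Filter.atTop, B₁' y = y ∧ A₂' y ≠ y := by
  obtain ⟨z₁, hz₁⟩ := Filter.eventually_atTop.1 heq
  obtain ⟨m, hm1, hmx, hA₁m, hB₁m, hA₂m, hB₂m, hCm⟩ := ((Filter.eventually_ge_atTop z₁).and
    ((Filter.eventually_ge_atTop x).and ((Filter.eventually_ge_atTop (A₁ x)).and
    ((Filter.eventually_ge_atTop (B₁ x)).and ((Filter.eventually_ge_atTop (A₂ x)).and
    ((Filter.eventually_ge_atTop (B₂ x)).and
    (Filter.eventually_all.2 fun i => Filter.eventually_ge_atTop (C i x)))))))).exists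
  obtain ⟨ψ, hψ, hψm, hran⟩ := exists_squeeze m
  have hI : (Set.range ψ).OrdConnected := by rw [hran]; exact Set.ordConnected_Iio
  set E := affineIso (m + 1) (m + 1) 2 two_pos with hE
  have hEran : ∀ y, E y ∈ Set.range ψ ↔ y ∈ Set.range ψ := by
    intro y; rw [hran]; simp only [hE, affineIso_apply, Set.mem_Iio]
    constructor <;> intro h <;> linarith
  have hEne : ∀ y, m + 1 < y → E y ≠ y := by
    intro y hy h; simp only [hE, affineIso_apply] at h; linarith
  have h1ran : ∀ y, (1 : ℝ ≃o ℝ) y ∈ Set.range ψ ↔ y ∈ Set.range ψ := fun y => Iff.rfl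
  obtain ⟨a₁, ha₁, ha₁'⟩ := exists_orderIso_embed hψ hI A₁ E hEran
  obtain ⟨b₁, hb₁, hb₁'⟩ := exists_orderIso_embed hψ hI B₁ 1 h1ran
  obtain ⟨a₂, ha₂, ha₂'⟩ := exists_orderIso_embed hψ hI A₂ E hEran
  obtain ⟨b₂, hb₂, hb₂'⟩ := exists_orderIso_embed hψ hI B₂ 1 h1ran
  choose c hc hc' using fun i => exists_orderIso_embed hψ hI (C i) 1 h1ran
  have hinv : ∀ {f F : ℝ ≃o ℝ}, (∀ t, f (ψ t) = ψ (F t)) → ∀ t, f⁻¹ (ψ t) = ψ (F⁻¹ t) := by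
    intro f F hf t
    have := hf (F⁻¹ t)
    rw [RelIso.apply_inv_self] at this
    rw [← this, RelIso.inv_apply_self]
  have hword : ∀ t, FreeGroup.lift c w (ψ t) = ψ (FreeGroup.lift C w t) := fun t =>
    ((lift_semiconj_line C c ψ Set.univ (by simp) (fun i t _ => (hc i t).symm) w t trivial).2).symm
  have comm_out : ∀ {a b : ℝ ≃o ℝ}, (∀ y ∉ Set.range ψ, a y = E y) →
      (∀ y ∉ Set.range ψ, b y = (1 : ℝ ≃o ℝ) y) → ∀ y ∉ Set.range ψ,
      (a * b * a⁻¹ * b⁻¹) y = y := by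
    intro a b ha hb y hy
    have hEy : E⁻¹ y ∉ Set.range ψ := by rw [← hEran]; simpa using hy
    have e1 : b⁻¹ y = y := by
      have := hb y hy
      nth_rw 1 [show y = b y from this.symm]; simp
    have e2 : a⁻¹ y = E⁻¹ y := by
      have := ha _ hEy
      rw [RelIso.apply_inv_self] at this
      nth_rw 1 [← this]; simp
    simp only [RelIso.mul_apply]
    rw [e1, e2, hb _ hEy, RelIso.coe_one, id, ha _ hEy]
    simp
  set hs := a₁ * b₁ * a₁⁻¹ * b₁⁻¹ with hhs
  set ks := a₂ * b₂ * a₂⁻¹ * b₂⁻¹ * FreeGroup.lift c w with hks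
  have hsψ : ∀ t, hs (ψ t) = ψ ((A₁ * B₁ * A₁⁻¹ * B₁⁻¹) t) := by
    intro t
    simp only [hhs, RelIso.mul_apply]
    rw [hinv hb₁, hinv ha₁, hb₁, ha₁]
  have hrels : hs * ks = 1 := by
    ext y
    by_cases hy : y ∈ Set.range ψ
    · obtain ⟨t, rfl⟩ := hy
      have e : ks (ψ t) = ψ ((A₂ * B₂ * A₂⁻¹ * B₂⁻¹ * FreeGroup.lift C w) t) := by
        simp only [hks, RelIso.mul_apply]
        rw [hword, hinv hb₂, hinv ha₂, hb₂, ha₂]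
      rw [RelIso.mul_apply, e, hsψ, ← RelIso.mul_apply, hrel]; rfl
    · have e : FreeGroup.lift c w y = y := lift_apply_eq_self c y (fun i => hc' i y hy) w
      have e2 : ks y = y := by
        rw [hks, RelIso.mul_apply, e]; exact comm_out ha₂' hb₂' y hy
      rw [RelIso.mul_apply, e2]
      exact comm_out ha₁' hb₁' y hy
  have hsid : ∀ y, m ≤ y → hs y = y := by
    intro y hmy
    by_cases hy : y ∈ Set.range ψ
    · obtain ⟨t, rfl⟩ := hy
      have : m ≤ t := by rwa [← hψm m le_rfl, hψ.le_iff_le] at hmy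
      rw [hsψ, hz₁ t (hm1.trans this)]
    · exact comm_out ha₁' hb₁' y hy
  have hscomm : ∀ d : ℝ ≃o ℝ, (∀ y ≤ m, d y = y) → d * hs * d⁻¹ = hs := by
    intro d hd
    rw [mul_inv_eq_iff_eq_mul]
    ext y
    simp only [RelIso.mul_apply]
    rcases le_total y m with hy | hy
    · rw [hd y hy, hd]
      rw [← hsid m le_rfl]; exact hs.monotone hy
    · rw [hsid y hy, hsid]
      rw [← hd m le_rfl]; exact d.monotone hy
  -- it suffices to conjugate the two halves so that no fixed point beyond `m` is shared
  suffices H : ∃ d e : ℝ ≃o ℝ, (∀ y ≤ m, d y = y) ∧ (∀ y ≤ m, e y = y) ∧ ∀ y, m < y →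
      a₁ (d⁻¹ y) = d⁻¹ y → b₁ (d⁻¹ y) = d⁻¹ y → a₂ (e⁻¹ y) = e⁻¹ y → b₂ (e⁻¹ y) = e⁻¹ y →
      ¬ ∀ i, c i (e⁻¹ y) = e⁻¹ y by
    obtain ⟨d, e, hd, he, hde⟩ := H
    have hinvid : ∀ {d : ℝ ≃o ℝ}, (∀ y ≤ m, d y = y) → ∀ y ≤ m, d⁻¹ y = y := fun hd y hy => by
      nth_rw 1 [← hd y hy]; simp
    have hconj_apply : ∀ {d f F : ℝ ≃o ℝ}, (∀ y ≤ m, d y = y) → (∀ t, f (ψ t) = ψ (F t)) →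
        F x ≤ m → ∀ y ≤ x, (d * f * d⁻¹) y = F y := by
      intro d f F hd hf hF y hy
      have h1 : F y ≤ m := (F.monotone hy).trans hF
      have h2 : f y = F y := by
        nth_rw 1 [← hψm y (hy.trans hmx)]; rw [hf, hψm _ h1]
      simp only [RelIso.mul_apply]
      rw [hinvid hd y (hy.trans hmx), h2, hd _ h1]
    have hconj_fix : ∀ {d f : ℝ ≃o ℝ} {y}, (d * f * d⁻¹) y = y → f (d⁻¹ y) = d⁻¹ y := by
      intro d f y hf
      have := congrArg (d⁻¹ : ℝ ≃o ℝ) hf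
      simpa using this
    have hconj_fix' : ∀ {d f F : ℝ ≃o ℝ}, (∀ y ≤ m, d y = y) → (∀ t, f (ψ t) = ψ (F t)) →
        ∀ y ≤ m, (d * f * d⁻¹) y = y → F y = y := by
      intro d f F hd hf y hy hfy
      have h1 := hconj_fix hfy
      rw [hinvid hd y hy] at h1
      nth_rw 1 2 [← hψm y hy] at h1
      rw [hf] at h1
      exact hψ.injective h1
    have hlift : FreeGroup.lift (fun i => e * c i * e⁻¹) w = e * FreeGroup.lift c w * e⁻¹ := by
      have : FreeGroup.lift (fun i => e * c i * e⁻¹) =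
          (MulAut.conj e).toMonoidHom.comp (FreeGroup.lift c) := by
        ext i; simp
      rw [this]; simp
    refine ⟨d * a₁ * d⁻¹, d * b₁ * d⁻¹, e * a₂ * e⁻¹, e * b₂ * e⁻¹, fun i => e * c i * e⁻¹,
      ?_, fun y hy => ⟨hconj_apply hd ha₁ hA₁m y hy, hconj_apply hd hb₁ hB₁m y hy,
        hconj_apply he ha₂ hA₂m y hy, hconj_apply he hb₂ hB₂m y hy,
        fun i => hconj_apply he (hc i) (hCm i) y hy⟩, fun y f1 f2 f3 f4 f5 => ?_, ?_⟩
    · have e1 : d * a₁ * d⁻¹ * (d * b₁ * d⁻¹) * (d * a₁ * d⁻¹)⁻¹ * (d * b₁ * d⁻¹)⁻¹ = hs := by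
        rw [← hscomm d hd, hhs]; group
      have e2 : e * a₂ * e⁻¹ * (e * b₂ * e⁻¹) * (e * a₂ * e⁻¹)⁻¹ * (e * b₂ * e⁻¹)⁻¹ *
          (e * FreeGroup.lift c w * e⁻¹) = e * ks * e⁻¹ := by rw [hks]; group
      rw [hlift, e1, e2]
      nth_rw 1 [← hscomm e he]
      rw [show e * hs * e⁻¹ * (e * ks * e⁻¹) = e * (hs * ks) * e⁻¹ by group, hrels]; group
    · rcases le_or_gt y m with hy | hy
      · exact hfix y (hconj_fix' hd ha₁ y hy f1) (hconj_fix' hd hb₁ y hy f2)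
          (hconj_fix' he ha₂ y hy f3) (hconj_fix' he hb₂ y hy f4)
          (fun i => hconj_fix' he (hc i) y hy (f5 i))
      · exact hde y hy (hconj_fix f1) (hconj_fix f2) (hconj_fix f3) (hconj_fix f4)
          fun i => hconj_fix (f5 i)
    · filter_upwards [(d⁻¹).tendsto_atTop.eventually_ge_atTop (m + 1),
        (e⁻¹).tendsto_atTop.eventually_gt_atTop (m + 1)] with y h1 h2
      constructor
      · have : d⁻¹ y ∉ Set.range ψ := by rw [hran]; simpa using h1
        simp only [RelIso.mul_apply]
        rw [hb₁' _ this]; simp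
      · intro h3
        have h4 := hconj_fix h3
        have : e⁻¹ y ∉ Set.range ψ := by rw [hran]; simpa using h2.le
        rw [ha₂' _ this] at h4
        exact hEne _ h2 h4
  -- the pushing homeomorphism
  have hpush : ∀ F : ℝ ≃o ℝ, F m ≠ m → ∃ d : ℝ ≃o ℝ, (∀ y ≤ m, d y = y) ∧
      ∀ f : ℝ ≃o ℝ, (∀ t, f (ψ t) = ψ (F t)) → ∀ y, m < y → f (d⁻¹ y) = d⁻¹ y → m + 1 < y := by
    intro F hF
    obtain ⟨m₂, hm₂, hm₂F⟩ : ∃ m₂ > m, ∀ t, m ≤ t → t < m₂ → F t ≠ t := by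
      have hopen : IsOpen {t | F t ≠ t} := isOpen_ne_fun F.continuous continuous_id
      have := (hopen.mem_nhds (show m ∈ {t | F t ≠ t} from hF))
      obtain ⟨u, hu, hu'⟩ := exists_Ico_subset_of_mem_nhds this ⟨m + 1, by linarith⟩
      exact ⟨u, hu, fun t h1 h2 => hu' ⟨h1, h2⟩⟩
    obtain ⟨m₁, hm₁, hm₁₂⟩ := exists_between hm₂
    have h1 : m < ψ m₁ := by rw [← hψm m le_rfl]; exact hψ (by simpa [hψm] using hm₁)
    -- `d` stretches `[m, ψ m₁]`, where `f` has no fixed point, onto `[m, m + 1]`.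
    obtain ⟨d, hd, hd'⟩ := exists_orderIso_glue m 1
      (affineIso m m (1 / (ψ m₁ - m)) (by apply div_pos one_pos; linarith)) (by simp)
    refine ⟨d, hd, fun f hf y hy hfy => ?_⟩
    by_contra! hcon
    have h2 : d (ψ m₁) = m + 1 := by
      rw [hd' _ h1.le, affineIso_apply]
      have : ψ m₁ - m ≠ 0 := by linarith
      field_simp
    have h3 : m < d⁻¹ y := by
      rw [← d.lt_iff_lt, RelIso.apply_inv_self, hd m le_rfl]; exact hy
    have h4 : d⁻¹ y ≤ ψ m₁ := by
      rw [← d.le_iff_le, RelIso.apply_inv_self, h2]; exact hcon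
    have h5 : d⁻¹ y ∈ Set.range ψ := hI.out ⟨m, hψm m le_rfl⟩ ⟨m₁, rfl⟩ ⟨h3.le, h4⟩
    obtain ⟨t, ht⟩ := h5
    rw [← ht, hf] at hfy
    rw [← ht] at h3 h4
    refine hm₂F t ?_ ((hψ.le_iff_le.1 h4).trans_lt hm₁₂) (hψ.injective hfy)
    rw [← hψ.le_iff_le, hψm m le_rfl]; exact h3.le
  have hout : ∀ y, m + 1 < y → y ∉ Set.range ψ := fun y hy => by rw [hran]; simpa using hy.le
  have ha₁ne : ∀ y, m + 1 < y → a₁ y ≠ y := fun y hy => by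
    rw [ha₁' y (hout y hy)]; exact hEne y hy
  have ha₂ne : ∀ y, m + 1 < y → a₂ y ≠ y := fun y hy => by
    rw [ha₂' y (hout y hy)]; exact hEne y hy
  -- Some generator moves `m`. Conjugating its half pushes that generator's fixed points beyond `m`
  -- past `m + 1`, where the expanding generator of the other, unconjugated half has none.
  by_cases c1 : A₁ m = m
  · by_cases c2 : B₁ m = m
    · by_cases c3 : A₂ m = m
      · by_cases c4 : B₂ m = m
        · have c5 := hfix m c1 c2 c3 c4
          push Not at c5
          obtain ⟨i, hi⟩ := c5
          obtain ⟨e, he, hpe⟩ := hpush (C i) hi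
          exact ⟨1, e, fun _ _ => rfl, he, fun y hy f1 _ _ _ f5 =>
            ha₁ne y (hpe (c i) (hc i) y hy (f5 i)) f1⟩
        · obtain ⟨e, he, hpe⟩ := hpush B₂ c4
          exact ⟨1, e, fun _ _ => rfl, he, fun y hy f1 _ _ f4 _ =>
            ha₁ne y (hpe _ hb₂ y hy f4) f1⟩
      · obtain ⟨e, he, hpe⟩ := hpush A₂ c3
        exact ⟨1, e, fun _ _ => rfl, he, fun y hy f1 _ f3 _ _ =>
          ha₁ne y (hpe _ ha₂ y hy f3) f1⟩
    · obtain ⟨d, hd, hpd⟩ := hpush B₁ c2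
      exact ⟨d, 1, hd, fun _ _ => rfl, fun y hy _ f2 f3 _ _ =>
        ha₂ne y (hpd _ hb₁ y hy f2) f3⟩
  · obtain ⟨d, hd, hpd⟩ := hpush A₁ c1
    exact ⟨d, 1, hd, fun _ _ => rfl, fun y hy f1 _ f3 _ _ =>
      ha₂ne y (hpd _ ha₁ y hy f1) f3⟩

/-! ### Tuples of homeomorphisms satisfying the surface relation -/

/-- The generators `a₁, …, a_{n+2}, b₁, …, b_{n+2}` of the surface group of genus `n + 2`. -/
abbrev SurfaceGen (n : ℕ) : Type := Fin (n + 2) ⊕ Fin (n + 2)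

theorem surfaceGen_forall {n : ℕ} {P : SurfaceGen n → Prop} : (∀ g, P g) ↔
    P (Sum.inl 0) ∧ P (Sum.inr 0) ∧ P (Sum.inl 1) ∧ P (Sum.inr 1) ∧
      ∀ i : Fin n ⊕ Fin n, P (Sum.map (fun j => j.succ.succ) (fun j => j.succ.succ) i) := by
  rw [Sum.forall]
  simp only [Fin.forall_fin_succ (n := n + 1), Fin.forall_fin_succ (n := n), Sum.forall,
    Sum.map_inl, Sum.map_inr, Fin.succ_zero_eq_one]
  tauto

theorem exists_right_end {n : ℕ} (T : SurfaceGen n → ℝ ≃o ℝ)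
    (hrel : FreeGroup.lift T (surfaceRelator (n + 2)) = 1) (hfix : ∀ y, ∃ g, T g y ≠ y) (x : ℝ) :
    ∃ T' : SurfaceGen n → ℝ ≃o ℝ, FreeGroup.lift T' (surfaceRelator (n + 2)) = 1 ∧
      (∀ g, ∀ y ≤ x, T' g y = T g y) ∧ (∀ y, ∃ g, T' g y ≠ y) ∧
      ∀ᶠ y in Filter.atTop, T' (Sum.inr 0) y = y ∧ T' (Sum.inl 1) y ≠ y := by
  rw [lift_surfaceRelator] at hrel
  have hfix' : ∀ y, ¬ ∀ g, T g y = y := fun y => by push Not; exact hfix y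
  simp only [surfaceGen_forall] at hfix'
  obtain ⟨A₁, B₁, A₂, B₂, C, h1, h2, h3, h4⟩ : ∃ (A₁' B₁' A₂' B₂' : ℝ ≃o ℝ)
      (C' : Fin n ⊕ Fin n → ℝ ≃o ℝ),
      A₁' * B₁' * A₁'⁻¹ * B₁'⁻¹ *
        (A₂' * B₂' * A₂'⁻¹ * B₂'⁻¹ * FreeGroup.lift C' (surfaceRelator n)) = 1 ∧
      (∀ y ≤ x, A₁' y = T (Sum.inl 0) y ∧ B₁' y = T (Sum.inr 0) y ∧ A₂' y = T (Sum.inl 1) y ∧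
        B₂' y = T (Sum.inr 1) y ∧ ∀ i, C' i y = T (Sum.map (fun j => j.succ.succ)
          (fun j => j.succ.succ) i) y) ∧
      (∀ y, A₁' y = y → B₁' y = y → A₂' y = y → B₂' y = y → ¬ ∀ i, C' i y = y) ∧
      ∀ᶠ y in Filter.atTop, B₁' y = y ∧ A₂' y ≠ y := by
    by_cases hev : ∀ᶠ z in Filter.atTop, (T (Sum.inl 0) * T (Sum.inr 0) * (T (Sum.inl 0))⁻¹ *
        (T (Sum.inr 0))⁻¹) z = z
    · exact exists_end_of_eventually_eq _ _ _ _ _ _ hrel x hev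
        fun y c1 c2 c3 c4 c5 => hfix' y ⟨c1, c2, c3, c4, c5⟩
    · obtain ⟨A₁, B₁, A₂, B₂, C, h1, h2, h3, h4⟩ :=
        exists_end_of_frequently_ne _ _ _ _ _ _ hrel x (Filter.not_eventually.1 hev)
      exact ⟨A₁, B₁, A₂, B₂, C, h1, h2, fun y c1 c2 c3 c4 c5 =>
        hfix' y (h3 y c1 c2 c3 c4 c5), h4⟩
  set T' : SurfaceGen n → ℝ ≃o ℝ := Sum.elim
    (Fin.cons A₁ (Fin.cons A₂ fun j => C (Sum.inl j)))
    (Fin.cons B₁ (Fin.cons B₂ fun j => C (Sum.inr j))) with hT'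
  have t1 : T' (Sum.inl 0) = A₁ := rfl
  have t2 : T' (Sum.inr 0) = B₁ := rfl
  have t3 : T' (Sum.inl 1) = A₂ := rfl
  have t4 : T' (Sum.inr 1) = B₂ := rfl
  have t5 : ∀ i, T' (Sum.map (fun j => j.succ.succ) (fun j => j.succ.succ) i) = C i := by
    rintro (j | j) <;> rfl
  refine ⟨T', ?_, ?_, fun y => ?_, by rw [t2, t3]; exact h4⟩
  · rw [lift_surfaceRelator, t1, t2, t3, t4]
    simp only [t5]; exact h1
  · rw [surfaceGen_forall, t1, t2, t3, t4]
    simp only [t5]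
    exact ⟨fun y hy => (h2 y hy).1, fun y hy => (h2 y hy).2.1, fun y hy => (h2 y hy).2.2.1,
      fun y hy => (h2 y hy).2.2.2.1, fun i y hy => (h2 y hy).2.2.2.2 i⟩
  · by_contra! hcon
    rw [surfaceGen_forall, t1, t2, t3, t4] at hcon
    simp only [t5] at hcon
    exact h3 y hcon.1 hcon.2.1 hcon.2.2.1 hcon.2.2.2.1 hcon.2.2.2.2

/-- Conjugation by `y ↦ -y`. -/
noncomputable def reflectHom : (ℝ ≃o ℝ) →* (ℝ ≃o ℝ) where
  toFun f :=
    { toFun := fun y => -f (-y)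
      invFun := fun y => -f.symm (-y)
      left_inv := fun y => by simp
      right_inv := fun y => by simp
      map_rel_iff' := by intro s t; simp }
  map_one' := by ext y; simp
  map_mul' f g := by ext y; simp

theorem reflectHom_apply (f : ℝ ≃o ℝ) (y : ℝ) : reflectHom f y = -f (-y) := rfl

theorem lift_comp_hom {ι G H : Type*} [Group G] [Group H] (φ : G →* H) (T : ι → G)
    (w : FreeGroup ι) : FreeGroup.lift (fun i => φ (T i)) w = φ (FreeGroup.lift T w) := by
  have : FreeGroup.lift (fun i => φ (T i)) = φ.comp (FreeGroup.lift T) := by ext i; simp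
  rw [this]; rfl

theorem exists_left_end {n : ℕ} (T : SurfaceGen n → ℝ ≃o ℝ)
    (hrel : FreeGroup.lift T (surfaceRelator (n + 2)) = 1) (hfix : ∀ y, ∃ g, T g y ≠ y) (x : ℝ) :
    ∃ T' : SurfaceGen n → ℝ ≃o ℝ, FreeGroup.lift T' (surfaceRelator (n + 2)) = 1 ∧
      (∀ g, ∀ y ≥ x, T' g y = T g y) ∧ (∀ y, ∃ g, T' g y ≠ y) ∧
      ∀ᶠ y in Filter.atBot, T' (Sum.inr 0) y = y ∧ T' (Sum.inl 1) y ≠ y := by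
  obtain ⟨T', h1, h2, h3, h4⟩ := exists_right_end (fun g => reflectHom (T g))
    (by rw [lift_comp_hom, hrel, map_one]) (fun y => by
      obtain ⟨g, hg⟩ := hfix (-y)
      exact ⟨g, fun h => hg (by rw [reflectHom_apply] at h; linarith)⟩) (-x)
  refine ⟨fun g => reflectHom (T' g), by rw [lift_comp_hom, h1, map_one], fun g y hy => ?_,
    fun y => ?_, ?_⟩
  · rw [reflectHom_apply, h2 g (-y) (neg_le_neg hy), reflectHom_apply]; simp
  · obtain ⟨g, hg⟩ := h3 (-y)
    exact ⟨g, fun h => hg (by rw [reflectHom_apply] at h; linarith)⟩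
  · filter_upwards [Filter.tendsto_neg_atBot_atTop.eventually h4] with y hy
    rw [reflectHom_apply, reflectHom_apply, hy.1]
    exact ⟨neg_neg y, fun h => hy.2 (by linarith)⟩

theorem exists_both_ends {n : ℕ} (T : SurfaceGen n → ℝ ≃o ℝ)
    (hrel : FreeGroup.lift T (surfaceRelator (n + 2)) = 1) (hfix : ∀ y, ∃ g, T g y ≠ y)
    (x z : ℝ) :
    ∃ T' : SurfaceGen n → ℝ ≃o ℝ, FreeGroup.lift T' (surfaceRelator (n + 2)) = 1 ∧
      (∀ g, ∀ y, x ≤ y → y ≤ z → T' g y = T g y) ∧ (∀ y, ∃ g, T' g y ≠ y) ∧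
      (∀ᶠ y in Filter.atBot, T' (Sum.inr 0) y = y ∧ T' (Sum.inl 1) y ≠ y) ∧
      ∀ᶠ y in Filter.atTop, T' (Sum.inr 0) y = y ∧ T' (Sum.inl 1) y ≠ y := by
  obtain ⟨T₁, h1, h2, h3, h4⟩ := exists_right_end T hrel hfix z
  obtain ⟨T₂, k1, k2, k3, k4⟩ := exists_left_end T₁ h1 h3 x
  refine ⟨T₂, k1, fun g y hx hz => by rw [k2 g y hx, h2 g y hz], k3, k4, ?_⟩
  filter_upwards [h4, Filter.eventually_ge_atTop x] with y hy hxy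
  rw [k2 _ y hxy, k2 _ y hxy]; exact hy

/-! ### Approximation on an interval bounded by common fixed points -/

/-- `T` is `ε`-close on `[a, b]` to a tuple supported in `[a, b]` that satisfies the surface
relation, has no common fixed point in `(a, b)`, and is such that near both end points `b₁` is
trivial while `a₂` moves every point. -/
def ApproxOn {n : ℕ} (T : SurfaceGen n → ℝ ≃o ℝ) (ε a b : ℝ) : Prop :=
  ∃ T' : SurfaceGen n → ℝ ≃o ℝ, FreeGroup.lift T' (surfaceRelator (n + 2)) = 1 ∧
    (∀ g y, y ≤ a ∨ b ≤ y → T' g y = y) ∧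
    (∀ g y, a ≤ y → y ≤ b → |T' g y - T g y| < ε) ∧
    (∀ y, a < y → y < b → ∃ g, T' g y ≠ y) ∧
    ∃ η > 0, ∀ y, a < y → y < b → y < a + η ∨ b - η < y →
      T' (Sum.inr 0) y = y ∧ T' (Sum.inl 1) y ≠ y

theorem exists_strictMono_range_eq_Ioo {a b : ℝ} (hab : a < b) :
    ∃ ψ : ℝ → ℝ, StrictMono ψ ∧ Continuous ψ ∧ Topology.IsEmbedding ψ ∧
      Set.range ψ = Set.Ioo a b := by
  let i : ℝ ≃o Set.Ioo (-1 : ℝ) 1 := orderIsoIooNegOneOne ℝ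
  let L : ℝ ≃o ℝ := affineIso (-1) a ((b - a) / 2) (by linarith)
  have hmono : StrictMono fun t => L (i t) := fun s t h => L.strictMono (i.strictMono h)
  have hran : Set.range (fun t => L (i t)) = Set.Ioo a b := by
    ext y
    constructor
    · rintro ⟨t, rfl⟩
      obtain ⟨h1, h2⟩ := (i t).2
      have e1 : L (-1) = a := by simp [L]
      have e2 : L 1 = b := by simp [L]; ring
      exact ⟨by rw [← e1]; exact L.strictMono h1, by rw [← e2]; exact L.strictMono h2⟩
    · rintro ⟨h1, h2⟩
      have h3 : L.symm y ∈ Set.Ioo (-1 : ℝ) 1 := by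
        constructor
        · rw [L.lt_symm_apply]; simpa [L] using h1
        · rw [L.symm_apply_lt]; simp [L]; linarith
      exact ⟨i.symm ⟨_, h3⟩, by simp⟩
  have hemb : Topology.IsEmbedding fun t => L (i t) :=
    L.toHomeomorph.isEmbedding.comp (Topology.IsEmbedding.subtypeVal.comp
      i.toHomeomorph.isEmbedding)
  exact ⟨_, hmono, hemb.continuous, hemb, hran⟩

theorem lift_embed_eq_one {ι : Type*} {ψ : ℝ → ℝ} (T₀ T' : ι → ℝ ≃o ℝ) (w : FreeGroup ι)
    (h : FreeGroup.lift T₀ w = 1) (h1 : ∀ i t, T' i (ψ t) = ψ (T₀ i t))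
    (h2 : ∀ i, ∀ y ∉ Set.range ψ, T' i y = y) : FreeGroup.lift T' w = 1 := by
  ext y
  by_cases hy : y ∈ Set.range ψ
  · obtain ⟨t, rfl⟩ := hy
    rw [← (lift_semiconj_line T₀ T' ψ Set.univ (by simp) (fun i t _ => (h1 i t).symm) w t trivial).2,
      h]; rfl
  · exact lift_apply_eq_self T' y (fun i => h2 i y hy) w

theorem exists_transport {n : ℕ} {a b : ℝ} {ψ : ℝ → ℝ} (hψ : StrictMono ψ)
    (hran : Set.range ψ = Set.Ioo a b)
    (T₀ : SurfaceGen n → ℝ ≃o ℝ)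
    (hrel : FreeGroup.lift T₀ (surfaceRelator (n + 2)) = 1) (hfix : ∀ y, ∃ g, T₀ g y ≠ y)
    (hbot : ∀ᶠ y in Filter.atBot, T₀ (Sum.inr 0) y = y ∧ T₀ (Sum.inl 1) y ≠ y)
    (htop : ∀ᶠ y in Filter.atTop, T₀ (Sum.inr 0) y = y ∧ T₀ (Sum.inl 1) y ≠ y) :
    ∃ T' : SurfaceGen n → ℝ ≃o ℝ, FreeGroup.lift T' (surfaceRelator (n + 2)) = 1 ∧
      (∀ g t, T' g (ψ t) = ψ (T₀ g t)) ∧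
      (∀ g y, y ≤ a ∨ b ≤ y → T' g y = y) ∧
      (∀ y, a < y → y < b → ∃ g, T' g y ≠ y) ∧
      ∃ η > 0, ∀ y, a < y → y < b → y < a + η ∨ b - η < y →
        T' (Sum.inr 0) y = y ∧ T' (Sum.inl 1) y ≠ y := by
  choose T' h1 h2 using fun g => exists_orderIso_embed hψ
    (by rw [hran]; exact Set.ordConnected_Ioo) (T₀ g) 1 (fun _ => Iff.rfl)
  have hmem : ∀ y, a < y → y < b → ∃ t, ψ t = y := fun y ha hb => by
    have : y ∈ Set.range ψ := by rw [hran]; exact ⟨ha, hb⟩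
    exact this
  have hin : ∀ t, a < ψ t ∧ ψ t < b := fun t => by
    have : ψ t ∈ Set.range ψ := ⟨t, rfl⟩
    rwa [hran] at this
  refine ⟨T', lift_embed_eq_one T₀ T' _ hrel h1 h2, h1, fun g y hy => ?_, fun y ha hb => ?_, ?_⟩
  · refine h2 g y ?_
    rw [hran, Set.mem_Ioo, not_and_or, not_lt, not_lt]; exact hy
  · obtain ⟨t, rfl⟩ := hmem y ha hb
    obtain ⟨g, hg⟩ := hfix t
    exact ⟨g, fun h => hg (hψ.injective (by rw [← h1, h]))⟩
  · obtain ⟨X, hX⟩ := Filter.eventually_atTop.1 htop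
    obtain ⟨Z, hZ⟩ := Filter.eventually_atBot.1 hbot
    have hX1 := hin X
    have hZ1 := hin Z
    refine ⟨min (ψ Z - a) (b - ψ X), lt_min (by linarith) (by linarith), fun y ha hb hy => ?_⟩
    obtain ⟨t, rfl⟩ := hmem y ha hb
    have key : T₀ (Sum.inr 0) t = t ∧ T₀ (Sum.inl 1) t ≠ t := by
      rcases hy with hy | hy
      · have := min_le_left (ψ Z - a) (b - ψ X)
        exact hZ t (hψ.lt_iff_lt.1 (by linarith : ψ t < ψ Z)).le
      · have := min_le_right (ψ Z - a) (b - ψ X)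
        exact hX t (hψ.lt_iff_lt.1 (by linarith : ψ X < ψ t)).le
    rw [h1, h1, key.1]
    exact ⟨rfl, fun h => key.2 (hψ.injective h)⟩

/-- On an interval shorter than `ε` any two tuples fixing the end points are `ε`-close, so the old
action can be discarded. The new one has `a₂` a conjugated translation and all other generators
trivial. -/
theorem approxOn_of_lt {n : ℕ} (T : SurfaceGen n → ℝ ≃o ℝ) {ε a b : ℝ} (hab : a < b)
    (hε : b - a < ε) (ha : ∀ g, T g a = a) (hb : ∀ g, T g b = b) : ApproxOn T ε a b := by
  obtain ⟨ψ, hψ, -, -, hran⟩ := exists_strictMono_range_eq_Ioo hab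
  classical
  set T₀ : SurfaceGen n → ℝ ≃o ℝ := Function.update 1 (Sum.inl 1) (affineIso 0 1 1 one_pos) with hT₀
  have e1 : T₀ (Sum.inl 1) = affineIso 0 1 1 one_pos := by simp [hT₀]
  have e2 : ∀ g, g ≠ Sum.inl 1 → T₀ g = 1 := fun g hg => by simp [hT₀, Function.update_of_ne hg]
  have hmove : ∀ y, T₀ (Sum.inl 1) y ≠ y := fun y => by rw [e1]; simp
  have hb0 : ∀ y, T₀ (Sum.inr 0) y = y := fun y => by rw [e2 _ (by simp)]; rfl
  have hrel : FreeGroup.lift T₀ (surfaceRelator (n + 2)) = 1 := by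
    rw [lift_surfaceRelator, e2 (Sum.inr 0) (by simp), e2 (Sum.inr 1) (by simp)]
    have : ∀ i : Fin n ⊕ Fin n,
        T₀ (Sum.map (fun j => j.succ.succ) (fun j => j.succ.succ) i) = 1 := by
      rintro (j | j)
      · refine e2 _ ?_
        simp only [Sum.map_inl, ne_eq, Sum.inl.injEq, ← Fin.succ_zero_eq_one, Fin.succ_inj]
        exact Fin.succ_ne_zero j
      · exact e2 _ (by simp)
    have h2 : FreeGroup.lift (fun i : Fin n ⊕ Fin n =>
        T₀ (Sum.map (fun j => j.succ.succ) (fun j => j.succ.succ) i)) (surfaceRelator n) = 1 := by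
      ext y
      exact lift_apply_eq_self _ y (fun i => by rw [this]; rfl) _
    rw [h2]; group
  obtain ⟨T', k1, -, k2, k3, k4⟩ := exists_transport hψ hran T₀ hrel
    (fun y => ⟨_, hmove y⟩) (Filter.Eventually.of_forall fun y => ⟨hb0 y, hmove y⟩)
    (Filter.Eventually.of_forall fun y => ⟨hb0 y, hmove y⟩)
  refine ⟨T', k1, k2, fun g y hay hyb => ?_, k3, k4⟩
  have h1 := (T g).monotone hay
  have h2 := (T g).monotone hyb
  have h3 := (T' g).monotone hay
  have h4 := (T' g).monotone hyb
  rw [ha] at h1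
  rw [hb] at h2
  rw [k2 g a (Or.inl le_rfl)] at h3
  rw [k2 g b (Or.inr le_rfl)] at h4
  rw [abs_lt]; constructor <;> linarith

/-- The interval is identified with the line and the action is changed only outside `[ψ x, ψ z]`.
There closeness is automatic: by monotonicity old and new values both lie within `ε` of the same end
point. -/
theorem approxOn_of_forall_ne {n : ℕ} (T : SurfaceGen n → ℝ ≃o ℝ)
    (hrel : FreeGroup.lift T (surfaceRelator (n + 2)) = 1) {ε a b : ℝ} (hε : 0 < ε) (hab : a < b)
    (ha : ∀ g, T g a = a) (hb : ∀ g, T g b = b) (hne : ∀ y, a < y → y < b → ∃ g, T g y ≠ y) :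
    ApproxOn T ε a b := by
  obtain ⟨ψ, hψ, -, -, hran⟩ := exists_strictMono_range_eq_Ioo hab
  have hmem : ∀ y, a < y → y < b → ∃ t, ψ t = y := fun y ha hb => by
    have : y ∈ Set.range ψ := by rw [hran]; exact ⟨ha, hb⟩
    exact this
  have hin : ∀ t, a < ψ t ∧ ψ t < b := fun t => by
    have : ψ t ∈ Set.range ψ := ⟨t, rfl⟩
    rwa [hran] at this
  choose R hR using fun g => exists_orderIso_restrict hψ (T g) (fun y => by
    rw [hran]
    simp only [Set.mem_Ioo]
    nth_rw 1 [← ha g, ← hb g]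
    rw [(T g).lt_iff_lt, (T g).lt_iff_lt])
  have hRrel : FreeGroup.lift R (surfaceRelator (n + 2)) = 1 := by
    ext t
    apply hψ.injective
    rw [(lift_semiconj_line R T ψ Set.univ (by simp) (fun i t _ => hR i t) _ t trivial).2, hrel]
    rfl
  have hRne : ∀ t, ∃ g, R g t ≠ t := fun t => by
    obtain ⟨g, hg⟩ := hne (ψ t) (hin t).1 (hin t).2
    exact ⟨g, fun h => hg (by rw [← hR, h])⟩
  set c := (a + b) / 2 with hc
  obtain ⟨a', ha'1, ha'2, ha'3⟩ : ∃ a', a < a' ∧ a' < c ∧ ∀ g, T g a' < a + ε := by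
    have h1 : ∀ᶠ y in 𝓝[>] a, ∀ g, T g y < a + ε := by
      rw [Filter.eventually_all]
      intro g
      have : Filter.Tendsto (T g) (𝓝[>] a) (𝓝 a) := by
        have := (T g).continuous.tendsto a
        rw [ha g] at this
        exact this.mono_left nhdsWithin_le_nhds
      exact this.eventually_lt_const (by linarith)
    have h2 : ∀ᶠ y in 𝓝[>] a, y ∈ Set.Ioo a c := Ioo_mem_nhdsGT (by linarith)
    obtain ⟨y, hy1, hy2⟩ := (h1.and h2).exists
    exact ⟨y, hy2.1, hy2.2, hy1⟩
  obtain ⟨b', hb'1, hb'2, hb'3⟩ : ∃ b', b' < b ∧ c < b' ∧ ∀ g, b - ε < T g b' := by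
    have h1 : ∀ᶠ y in 𝓝[<] b, ∀ g, b - ε < T g y := by
      rw [Filter.eventually_all]
      intro g
      have : Filter.Tendsto (T g) (𝓝[<] b) (𝓝 b) := by
        have := (T g).continuous.tendsto b
        rw [hb g] at this
        exact this.mono_left nhdsWithin_le_nhds
      exact this.eventually_const_lt (by linarith)
    have h2 : ∀ᶠ y in 𝓝[<] b, y ∈ Set.Ioo c b := Ioo_mem_nhdsLT (by linarith)
    obtain ⟨y, hy1, hy2⟩ := (h1.and h2).exists
    exact ⟨y, hy2.2, hy2.1, hy1⟩
  obtain ⟨x, rfl⟩ := hmem a' ha'1 (by linarith)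
  obtain ⟨z, rfl⟩ := hmem b' (by linarith) hb'1
  have hxz : x ≤ z := hψ.le_iff_le.1 (by linarith)
  obtain ⟨T₀, k1, k2, k3, k4, k5⟩ := exists_both_ends R hRrel hRne x z
  obtain ⟨T', l1, l2, l3, l4, l5⟩ := exists_transport hψ hran T₀ k1 k3 k4 k5
  have hagree : ∀ g t, x ≤ t → t ≤ z → T' g (ψ t) = T g (ψ t) := fun g t h1 h2 => by
    rw [l2, k2 g t h1 h2, hR]
  refine ⟨T', l1, l3, fun g y hay hyb => ?_, l4, l5⟩
  have h1 := (T g).monotone hay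
  have h2 := (T g).monotone hyb
  have h3 := (T' g).monotone hay
  have h4 := (T' g).monotone hyb
  rw [ha] at h1
  rw [hb] at h2
  rw [l3 g a (Or.inl le_rfl)] at h3
  rw [l3 g b (Or.inr le_rfl)] at h4
  rcases le_or_gt y (ψ x) with hx | hx
  · have h5 := (T g).monotone hx
    have h6 := (T' g).monotone hx
    rw [hagree g x le_rfl hxz] at h6
    have := ha'3 g
    rw [abs_lt]; constructor <;> linarith
  · rcases le_or_gt (ψ z) y with hz | hz
    · have h5 := (T g).monotone hz
      have h6 := (T' g).monotone hz
      rw [hagree g z hxz le_rfl] at h6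
      have := hb'3 g
      rw [abs_lt]; constructor <;> linarith
    · obtain ⟨t, rfl⟩ := hmem y (by have := (hin x).1; linarith) (by have := (hin z).2; linarith)
      rw [hagree g t (hψ.le_iff_le.1 hx.le) (hψ.le_iff_le.1 hz.le)]
      simpa using hε

/-! ### Removing a common fixed point by a bump -/

/-- If `f` commutes with `b₁`, then `[a₁ f, b₁] = [a₁, b₁]`. -/
theorem lift_update_eq_one {n : ℕ} {G : Type*} [Group G] (T : SurfaceGen n → G)
    (hrel : FreeGroup.lift T (surfaceRelator (n + 2)) = 1) (f : G)
    (hf : f * T (Sum.inr 0) = T (Sum.inr 0) * f) :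
    FreeGroup.lift (Function.update T (Sum.inl 0) (T (Sum.inl 0) * f))
      (surfaceRelator (n + 2)) = 1 := by
  have e1 : ∀ g, g ≠ Sum.inl 0 → Function.update T (Sum.inl 0) (T (Sum.inl 0) * f) g = T g :=
    fun g hg => Function.update_of_ne hg _ _
  have e2 : ∀ i : Fin n ⊕ Fin n, Sum.map (fun j => j.succ.succ) (fun j => j.succ.succ) i ≠
      (Sum.inl 0 : SurfaceGen n) := by
    rintro (j | j)
    · simp [Fin.succ_ne_zero]
    · simp
  rw [lift_surfaceRelator] at hrel ⊢
  rw [Function.update_self, e1 (Sum.inr 0) (by simp), e1 (Sum.inl 1) (by simp),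
    e1 (Sum.inr 1) (by simp)]
  simp only [e1 _ (e2 _)]
  rw [← hrel]
  congr 1
  rw [mul_inv_rev, mul_assoc (T (Sum.inl 0)) f, hf]
  group

/-- Half of a tent function of Lipschitz constant one is added to the identity, which keeps it
increasing. -/
theorem exists_bump (b : ℝ) {η : ℝ} (hη : 0 < η) : ∃ f : ℝ ≃o ℝ,
    (∀ y, |y - b| < η → y < f y) ∧ ∀ y, η ≤ |y - b| → f y = y := by
  have hmono : StrictMono fun y => y + max 0 (η - |y - b|) / 2 := by
    intro y z hyz
    have h1 : max 0 (η - |y - b|) ≤ max 0 (η - |z - b|) + (z - y) := by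
      refine max_le (by have := le_max_left 0 (η - |z - b|); linarith) ?_
      have h2 := le_max_right 0 (η - |z - b|)
      have h3 : |z - b| ≤ |y - b| + |z - y| := by
        have := abs_add_le (y - b) (z - y); rwa [show y - b + (z - y) = z - b by ring] at this
      rw [abs_of_pos (by linarith : 0 < z - y)] at h3
      linarith
    dsimp only; linarith
  have hsurj : Function.Surjective fun y => y + max 0 (η - |y - b|) / 2 := by
    have hnonneg : ∀ y, 0 ≤ max 0 (η - |y - b|) / 2 := fun y => by positivity
    refine Continuous.surjective (by fun_prop) ?_ ?_
    · exact Filter.tendsto_atTop_mono (fun y => by have := hnonneg y; simp only [id]; linarith)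
        Filter.tendsto_id
    · refine Filter.tendsto_atBot_mono (f := fun y => y + η / 2) (fun y => ?_)
        (Filter.tendsto_atBot_add_const_right _ _ Filter.tendsto_id)
      have : max 0 (η - |y - b|) ≤ η := max_le hη.le (by have := abs_nonneg (y - b); linarith)
      linarith
  refine ⟨hmono.orderIsoOfSurjective _ hsurj, fun y hy => ?_, fun y hy => ?_⟩
  · simp only [StrictMono.coe_orderIsoOfSurjective]
    rw [max_eq_right (by linarith)]; linarith
  · simp only [StrictMono.coe_orderIsoOfSurjective]
    rw [max_eq_left (by linarith)]; simp

theorem commute_of_disjoint_support {f B : ℝ ≃o ℝ} (h : ∀ y, f y ≠ y → B y = y) :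
    f * B = B * f := by
  ext y
  simp only [RelIso.mul_apply]
  by_cases hy : f y = y
  · rw [hy]
    by_contra hcon
    have := h _ hcon
    exact hcon (by rw [B.injective this, hy])
  · rw [h y hy, h (f y) fun h' => hy (f.injective h')]

/-- After gluing, `b` is the only common fixed point inside. Near `b` the generator `b₁` is trivial,
so composing `a₁` with a bump there preserves the relation and moves `b`, while `a₂` still moves the
other points near `b`. -/
theorem ApproxOn.trans {n : ℕ} {T : SurfaceGen n → ℝ ≃o ℝ} {ε a b c : ℝ} (hε : 0 < ε)
    (hab : a < b) (hbc : b < c) (hb : ∀ g, T g b = b) (h₁ : ApproxOn T ε a b)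
    (h₂ : ApproxOn T ε b c) : ApproxOn T ε a c := by
  classical
  obtain ⟨T₁, r1, s1, c1, n1, η₁, hη₁, e1⟩ := h₁
  obtain ⟨T₂, r2, s2, c2, n2, η₂, hη₂, e2⟩ := h₂
  choose T₃ hl hr using fun g => exists_orderIso_glue b (T₁ g) (T₂ g)
    (by rw [s1 g b (Or.inr le_rfl), s2 g b (Or.inl le_rfl)])
  have h3b : ∀ g, T₃ g b = b := fun g => by rw [hl g b le_rfl, s1 g b (Or.inr le_rfl)]
  have hrel3 : FreeGroup.lift T₃ (surfaceRelator (n + 2)) = 1 := by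
    ext y
    rcases le_total y b with hy | hy
    · have := (lift_semiconj_line T₃ T₁ id (Set.Iic b) (fun g y => by
        simp only [Set.mem_Iic]; nth_rw 1 [← h3b g]; exact (T₃ g).le_iff_le)
        (fun g y hy => hl g y hy) (surfaceRelator (n + 2)) y hy).2
      simpa [r1] using this
    · have := (lift_semiconj_line T₃ T₂ id (Set.Ici b) (fun g y => by
        simp only [Set.mem_Ici]; nth_rw 1 [← h3b g]; exact (T₃ g).le_iff_le)
        (fun g y hy => hr g y hy) (surfaceRelator (n + 2)) y hy).2
      simpa [r2] using this
  -- Near `b` the old and the glued `a₁` are both within `ε / 2` of `b`, so the bump costs less than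
  -- `ε`.
  obtain ⟨η₃, hη₃, h3⟩ : ∃ η > 0, ∀ y, |y - b| < η →
      |T₃ (Sum.inl 0) y - b| < ε / 2 ∧ |T (Sum.inl 0) y - b| < ε / 2 := by
    obtain ⟨δ, hδ, hδ'⟩ := Metric.continuousAt_iff.1
      ((T₃ (Sum.inl 0)).continuous.continuousAt (x := b)) (ε / 2) (by linarith)
    obtain ⟨δ', hδ1, hδ2⟩ := Metric.continuousAt_iff.1
      ((T (Sum.inl 0)).continuous.continuousAt (x := b)) (ε / 2) (by linarith)
    rw [h3b] at hδ'
    rw [hb] at hδ2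
    exact ⟨min δ δ', lt_min hδ hδ1, fun y hy => ⟨hδ' (hy.trans_le (min_le_left _ _)),
      hδ2 (hy.trans_le (min_le_right _ _))⟩⟩
  obtain ⟨η, hη, hη'⟩ : ∃ η > 0, η < η₁ ∧ η < η₂ ∧ η < η₃ ∧ η < b - a ∧ η < c - b := by
    have : 0 < min η₁ (min η₂ (min η₃ (min (b - a) (c - b)))) := by
      simp only [lt_min_iff]
      exact ⟨hη₁, hη₂, hη₃, by linarith, by linarith⟩
    obtain ⟨η, h1, h2⟩ := exists_between this
    simp only [lt_min_iff] at h2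
    exact ⟨η, h1, h2⟩
  obtain ⟨k1, k2, k3, k4, k5⟩ := hη'
  obtain ⟨f, hf1, hf2⟩ := exists_bump b hη
  have hfne : ∀ y, f y ≠ y → |y - b| < η := fun y hy => by
    by_contra! h; exact hy (hf2 y h)
  have hend : ∀ y, |y - b| < η → T₃ (Sum.inr 0) y = y ∧ (y ≠ b → T₃ (Sum.inl 1) y ≠ y) := by
    intro y hy
    rw [abs_lt] at hy
    rcases lt_trichotomy y b with hyb | rfl | hyb
    · rw [hl _ y hyb.le, hl _ y hyb.le]
      have := e1 y (by linarith) hyb (Or.inr (by linarith))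
      exact ⟨this.1, fun _ => this.2⟩
    · exact ⟨h3b _, fun h => absurd rfl h⟩
    · rw [hr _ y hyb.le, hr _ y hyb.le]
      have := e2 y hyb (by linarith) (Or.inl (by linarith))
      exact ⟨this.1, fun _ => this.2⟩
  have hcomm : f * T₃ (Sum.inr 0) = T₃ (Sum.inr 0) * f :=
    commute_of_disjoint_support fun y hy => (hend y (hfne y hy)).1
  have hfin : ∀ y, |y - b| < η → |f y - b| < η := by
    intro y hy
    by_contra! h
    have h1 := hf2 _ h
    rw [f.injective h1] at h
    linarith
  set T₄ := Function.update T₃ (Sum.inl 0) (T₃ (Sum.inl 0) * f) with hT₄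
  have t1 : ∀ g, g ≠ Sum.inl 0 → T₄ g = T₃ g := fun g hg => Function.update_of_ne hg _ _
  have t2 : T₄ (Sum.inl 0) = T₃ (Sum.inl 0) * f := Function.update_self ..
  have t3 : ∀ g y, η ≤ |y - b| → T₄ g y = T₃ g y := by
    intro g y hy
    by_cases hg : g = Sum.inl 0
    · rw [hg, t2, RelIso.mul_apply, hf2 y hy]
    · rw [t1 g hg]
  have hout : ∀ y, y ≤ a ∨ c ≤ y → η ≤ |y - b| := by
    rintro y (h | h)
    · rw [abs_of_neg (by linarith)]; linarith
    · rw [abs_of_pos (by linarith)]; linarith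
  have close3 : ∀ g y, a ≤ y → y ≤ c → |T₃ g y - T g y| < ε := by
    intro g y h1 h2
    rcases le_total y b with h | h
    · rw [hl g y h]; exact c1 g y h1 h
    · rw [hr g y h]; exact c2 g y h h2
  refine ⟨T₄, lift_update_eq_one T₃ hrel3 f hcomm, fun g y hy => ?_, fun g y h1 h2 => ?_,
    fun y h1 h2 => ?_, min (min η₁ η₂) (min (b - a) (c - b)),
    lt_min (lt_min hη₁ hη₂) (lt_min (by linarith) (by linarith)), fun y h1 h2 h => ?_⟩
  · rw [t3 g y (hout y hy)]
    rcases hy with hy | hy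
    · rw [hl g y (by linarith), s1 g y (Or.inl hy)]
    · rw [hr g y (by linarith), s2 g y (Or.inr hy)]
  · by_cases hg : g = Sum.inl 0
    · rcases lt_or_ge (|y - b|) η with hy | hy
      · rw [hg, t2, RelIso.mul_apply]
        have h3' := (h3 (f y) ((hfin y hy).trans k3)).1
        have h4' := (h3 y (hy.trans k3)).2
        rw [abs_lt] at h3' h4' ⊢
        constructor <;> linarith
      · rw [t3 g y hy]; exact close3 g y h1 h2
    · rw [t1 g hg]; exact close3 g y h1 h2
  · rcases lt_or_ge (|y - b|) η with hy | hy
    · by_cases hyb : y = b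
      · refine ⟨Sum.inl 0, ?_⟩
        rw [t2, hyb, RelIso.mul_apply]
        have h4 : b < f b := hf1 b (by simpa using hη)
        have h5 := (T₃ (Sum.inl 0)).strictMono h4
        rw [h3b] at h5
        exact h5.ne'
      · exact ⟨Sum.inl 1, by rw [t1 _ (by simp)]; exact (hend y hy).2 hyb⟩
    · have hyb : y ≠ b := by rintro rfl; simp at hy; linarith
      rcases hyb.lt_or_gt with h | h
      · obtain ⟨g, hg⟩ := n1 y h1 h
        exact ⟨g, by rwa [t3 g y hy, hl g y h.le]⟩
      · obtain ⟨g, hg⟩ := n2 y h h2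
        exact ⟨g, by rwa [t3 g y hy, hr g y h.le]⟩
  · rw [t1 _ (by simp), t1 _ (by simp)]
    have m1 := min_le_left (min η₁ η₂) (min (b - a) (c - b))
    have m2 := min_le_right (min η₁ η₂) (min (b - a) (c - b))
    rcases h with h | h
    · have m3 := m1.trans (min_le_left η₁ η₂)
      have m4 := m2.trans (min_le_left (b - a) (c - b))
      have hyb : y < b := by linarith
      rw [hl _ y hyb.le, hl _ y hyb.le]
      exact e1 y h1 hyb (Or.inl (by linarith))
    · have m3 := m1.trans (min_le_right η₁ η₂)
      have m4 := m2.trans (min_le_right (b - a) (c - b))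
      have hyb : b < y := by linarith
      rw [hr _ y hyb.le, hr _ y hyb.le]
      exact e2 y hyb h2 (Or.inr (by linarith))

/-- A supremum argument over the common fixed points that can be reached from `a`. Short steps use
`approxOn_of_lt`, long gaps use `approxOn_of_forall_ne`, and steps are joined by `ApproxOn.trans`.
-/
theorem approxOn_of_fixed {n : ℕ} (T : SurfaceGen n → ℝ ≃o ℝ)
    (hrel : FreeGroup.lift T (surfaceRelator (n + 2)) = 1) {ε a b : ℝ} (hε : 0 < ε) (hab : a < b)
    (ha : ∀ g, T g a = a) (hb : ∀ g, T g b = b) : ApproxOn T ε a b := by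
  set F : Set ℝ := {y | ∀ g, T g y = y} with hF
  have hFc : IsClosed F := by
    have : F = ⋂ g, {y | T g y = y} := by ext; simp [hF]
    rw [this]
    exact isClosed_iInter fun g => isClosed_eq (T g).continuous continuous_id
  set S : Set ℝ := {y | a ≤ y ∧ y ≤ b ∧ y ∈ F ∧ (y = a ∨ ApproxOn T ε a y)} with hS
  have haS : a ∈ S := ⟨le_rfl, hab.le, ha, Or.inl rfl⟩
  have hbdd : BddAbove S := ⟨b, fun y hy => hy.2.1⟩
  have hstep : ∀ y z, y ∈ S → y < z → z ≤ b → z ∈ F → ApproxOn T ε y z → z ∈ S := by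
    rintro y z ⟨h1, h2, h3, h4⟩ hyz hzb hz hap
    refine ⟨h1.trans hyz.le, hzb, hz, Or.inr ?_⟩
    rcases h4 with rfl | h4
    · exact hap
    · rcases h1.eq_or_lt with rfl | h1
      · exact hap
      · exact ApproxOn.trans hε h1 hyz h3 h4 hap
  set s := sSup S with hs
  have hsF : s ∈ F := hFc.closure_subset_iff.2 (fun y hy => hy.2.2.1) (csSup_mem_closure ⟨a, haS⟩ hbdd)
  have hsb : s ≤ b := csSup_le ⟨a, haS⟩ fun y hy => hy.2.1
  have hsS : s ∈ S := by
    -- The supremum is attained: the last step to it from a reachable point within `ε` is short.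
    obtain ⟨y, hyS, hy⟩ := exists_lt_of_lt_csSup ⟨a, haS⟩ (show s - ε < sSup S by rw [← hs]; linarith)
    rcases (le_csSup hbdd hyS).eq_or_lt with h | h
    · rw [hs, ← h]; exact hyS
    · exact hstep y s hyS h hsb hsF (approxOn_of_lt T h (by linarith) hyS.2.2.1 hsF)
  rcases hsb.eq_or_lt with h | hsb
  · rcases hsS.2.2.2 with h' | h'
    · linarith
    · rwa [h] at h'
  exfalso
  have hmax : ∀ z ∈ S, z ≤ s := fun z hz => le_csSup hbdd hz
  -- A common fixed point within `ε` beyond `s` would be reachable by a short step, so a least one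
  -- beyond `s` exists and bounds a genuine gap.
  have hgap : ∀ y ∈ F, s < y → y ≤ b → s + ε ≤ y := by
    intro y hy h1 h2
    by_contra! h3
    have := hmax y (hstep s y hsS h1 h2 hy (approxOn_of_lt T h1 (by linarith) hsF hy))
    linarith
  have hcomp : IsCompact (F ∩ Set.Icc (s + ε) b) := isCompact_Icc.inter_left hFc
  obtain ⟨y, ⟨hyF, hy1, hy2⟩, hleast⟩ :=
    hcomp.exists_isLeast ⟨b, hb, hgap b hb hsb le_rfl, le_rfl⟩
  have hsy : s < y := by linarith
  have := hmax y (hstep s y hsS hsy hy2 hyF (approxOn_of_forall_ne T hrel hε hsy hsF hyF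
    fun z h1 h2 => by
      by_contra! hz
      have := hleast ⟨hz, hgap z hz h1 (h2.le.trans hy2), h2.le.trans hy2⟩
      linarith))
  linarith

/-! ### Convergence of representations -/

/-- The homomorphism underlying a representation. -/
def HomeoRep.hom {M : Type*} [TopologicalSpace M] {G : Type*} [Group G] {H : Subgroup (M ≃ₜ M)}
    (ρ : HomeoRep G H) : G →* H := ρ

theorem exists_rep_of_tuple {M : Type*} [TopologicalSpace M] {H : Subgroup (M ≃ₜ M)} {q : ℕ}
    (τ : Fin q ⊕ Fin q → H) (h : FreeGroup.lift τ (surfaceRelator q) = 1) :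
    ∃ ρ : HomeoRep (SurfaceGroup q) H, ∀ w, ρ.hom (PresentedGroup.mk _ w) = FreeGroup.lift τ w :=
  ⟨PresentedGroup.toGroup (rels := {surfaceRelator q}) (f := τ) (by simpa using h),
    fun _ => rfl⟩

theorem HomeoRep.hom_mk {M : Type*} [TopologicalSpace M] {H : Subgroup (M ≃ₜ M)} {q : ℕ}
    (ρ : HomeoRep (SurfaceGroup q) H) (w : FreeGroup (Fin q ⊕ Fin q)) :
    ρ.hom (PresentedGroup.mk _ w) =
      FreeGroup.lift (fun g => ρ.hom (PresentedGroup.of g)) w := by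
  have : ρ.hom.comp (PresentedGroup.mk _) =
      FreeGroup.lift (fun g => ρ.hom (PresentedGroup.of g)) := by
    ext g; simp [PresentedGroup.of]
  rw [← this]; rfl

theorem HomeoRep.lift_relator {M : Type*} [TopologicalSpace M] {H : Subgroup (M ≃ₜ M)} {q : ℕ}
    (ρ : HomeoRep (SurfaceGroup q) H) :
    FreeGroup.lift (fun g => ρ.hom (PresentedGroup.of g)) (surfaceRelator q) = 1 := by
  rw [← HomeoRep.hom_mk, PresentedGroup.one_of_mem (by simp), map_one]

theorem exists_mem_of_tendsto {M : Type*} [TopologicalSpace M] {H : Subgroup (M ≃ₜ M)} {q : ℕ}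
    (ρ : HomeoRep (SurfaceGroup q) H) {U : Set (HomeoRep (SurfaceGroup q) H)} (hU : U ∈ 𝓝 ρ)
    (u : ℕ → HomeoRep (SurfaceGroup q) H)
    (h : ∀ w, Filter.Tendsto (fun k => ((((u k).hom (PresentedGroup.mk _ w) : M ≃ₜ M)) : C(M, M)))
      Filter.atTop (𝓝 ((ρ.hom (PresentedGroup.mk _ w) : M ≃ₜ M) : C(M, M)))) : ∃ k, u k ∈ U := by
  have : Filter.Tendsto u Filter.atTop (𝓝 ρ) := by
    rw [nhds_induced, Filter.tendsto_comap_iff, tendsto_pi_nhds]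
    intro g
    obtain ⟨w, rfl⟩ := PresentedGroup.mk_surjective _ g
    rw [nhds_subtype_eq_comap, Filter.tendsto_comap_iff, nhds_induced, Filter.tendsto_comap_iff]
    exact h w
  exact (this.eventually_mem hU).exists

theorem TendstoUniformly.lift_freeGroup {ι G X : Type*} [Group G] [UniformSpace X] [MulAction G X]
    (u : ℕ → ι → G) (T : ι → G) (h1 : ∀ i, UniformContinuous fun x : X => T i • x)
    (h2 : ∀ i, UniformContinuous fun x : X => (T i)⁻¹ • x)
    (h : ∀ i, TendstoUniformly (fun k (x : X) => u k i • x) (fun x => T i • x) Filter.atTop)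
    (w : FreeGroup ι) : TendstoUniformly (fun k (x : X) => FreeGroup.lift (u k) w • x)
      (fun x => FreeGroup.lift T w • x) Filter.atTop := by
  have key : TendstoUniformly (fun k (x : X) => FreeGroup.lift (u k) w • x)
      (fun x => FreeGroup.lift T w • x) Filter.atTop ∧
      UniformContinuous fun x : X => FreeGroup.lift T w • x := by
    induction w using FreeGroup.induction_on with
    | C1 =>
      refine ⟨fun V hV => Filter.Eventually.of_forall fun k x => ?_, ?_⟩
      · simpa using refl_mem_uniformity hV
      · simp only [map_one, one_smul]; exact uniformContinuous_id
    | of i => exact ⟨by simpa using h i, by simpa using h1 i⟩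
    | inv_of i _ =>
      refine ⟨fun V hV => ?_, by simpa using h2 i⟩
      -- `T⁻¹ (u k x)` converges uniformly to `x`; evaluating at `(u k)⁻¹ x` gives the convergence
      -- of the inverses.
      have := (h2 i).comp_tendstoUniformly (h i)
      filter_upwards [this _ (symm_le_uniformity hV)] with k hk x
      have := hk ((u k i)⁻¹ • x)
      simpa using this
    | mul v w hv hw =>
      refine ⟨fun V hV => ?_, by simp only [map_mul, mul_smul]; exact hv.2.comp hw.2⟩
      obtain ⟨W, hW, hWV⟩ := comp_mem_uniformity_sets hV
      filter_upwards [hv.1 W hW, (hv.2.comp_tendstoUniformly hw.1) W hW] with k k1 k2 x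
      simp only [map_mul, mul_smul]
      exact hWV (SetRel.prodMk_mem_comp (k2 x) (k1 _))
  exact key.1

theorem uniformContinuous_of_eq_outside {f : ℝ ≃o ℝ} {a b : ℝ}
    (hf : ∀ y, y ≤ a ∨ b ≤ y → f y = y) : UniformContinuous f := by
  have h1 : HasCompactSupport fun y => f y - y :=
    HasCompactSupport.intro (isCompact_Icc (a := a) (b := b)) fun y hy => by
      rw [Set.mem_Icc, not_and_or, not_le, not_le] at hy
      rw [hf y (hy.imp le_of_lt le_of_lt), sub_self]
  have h2 : UniformContinuous fun y => f y - y :=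
    h1.uniformContinuous_of_continuous (f.continuous.sub continuous_id)
  have := h2.add uniformContinuous_id
  simpa using this

theorem inv_eq_outside {f : ℝ ≃o ℝ} {a b : ℝ} (hf : ∀ y, y ≤ a ∨ b ≤ y → f y = y) :
    ∀ y, y ≤ a ∨ b ≤ y → f⁻¹ y = y := fun y hy => by
  nth_rw 1 [← hf y hy]; simp

/-! ### The line -/

/-- Increasing homeomorphisms of the line as order isomorphisms. -/
noncomputable def HomeoPlusReal.toOrderIso : HomeoPlusReal →* (ℝ ≃o ℝ) where
  toFun f :=
    { toEquiv := (f : ℝ ≃ₜ ℝ).toEquiv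
      map_rel_iff' := fun {_ _} => StrictMono.le_iff_le f.2 }
  map_one' := rfl
  map_mul' _ _ := rfl

/-- Order isomorphisms of the line as increasing homeomorphisms. -/
noncomputable def HomeoPlusReal.ofOrderIso : (ℝ ≃o ℝ) →* HomeoPlusReal where
  toFun f := ⟨f.toHomeomorph, f.strictMono⟩
  map_one' := rfl
  map_mul' _ _ := rfl

theorem HomeoPlusReal.ofOrderIso_apply (f : ℝ ≃o ℝ) (y : ℝ) :
    (HomeoPlusReal.ofOrderIso f : ℝ ≃ₜ ℝ) y = f y := rfl

/-- The line becomes `(0, 1)`, with `0` and `1` as fixed points of the extended action, and is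
approximated there uniformly. -/
theorem exists_mem_globalFix_eq_empty_real {n : ℕ}
    (ρ : HomeoRep (SurfaceGroup (n + 2)) HomeoPlusReal) {U} (hU : U ∈ 𝓝 ρ) :
    ∃ ρ' ∈ U, ρ'.globalFix = ∅ := by
  obtain ⟨ψ, hψ, hψc, hψe, hran⟩ := exists_strictMono_range_eq_Ioo (zero_lt_one (α := ℝ))
  set R : SurfaceGen n → ℝ ≃o ℝ :=
    fun g => HomeoPlusReal.toOrderIso (ρ.hom (PresentedGroup.of g)) with hR
  have hRw : ∀ w, FreeGroup.lift R w =
      HomeoPlusReal.toOrderIso (ρ.hom (PresentedGroup.mk _ w)) := fun w => by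
    rw [hR, lift_comp_hom, HomeoRep.hom_mk]
  have hRrel : FreeGroup.lift R (surfaceRelator (n + 2)) = 1 := by
    rw [hRw, HomeoRep.hom_mk, HomeoRep.lift_relator, map_one]
  choose T hT1 hT2 using fun g => exists_orderIso_embed hψ
    (by rw [hran]; exact Set.ordConnected_Ioo) (R g) 1 (fun _ => Iff.rfl)
  have hTrel := lift_embed_eq_one R T _ hRrel hT1 hT2
  have hTout : ∀ g y, y ≤ 0 ∨ 1 ≤ y → T g y = y := fun g y hy => by
    refine hT2 g y ?_
    rw [hran, Set.mem_Ioo, not_and_or, not_lt, not_lt]; exact hy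
  choose T' r s c nf _ using fun k : ℕ => approxOn_of_fixed T hTrel
    (Nat.one_div_pos_of_nat (α := ℝ) (n := k)) zero_lt_one
    (fun g => hTout g 0 (Or.inl le_rfl)) (fun g => hTout g 1 (Or.inr le_rfl))
  choose R' hR' using fun k g => exists_orderIso_restrict hψ (T' k g) (fun y => by
    rw [hran]
    simp only [Set.mem_Ioo]
    nth_rw 1 [← s k g 0 (Or.inl le_rfl), ← s k g 1 (Or.inr le_rfl)]
    rw [(T' k g).lt_iff_lt, (T' k g).lt_iff_lt])
  have hR'w : ∀ k w t, ψ (FreeGroup.lift (R' k) w t) = FreeGroup.lift (T' k) w (ψ t) :=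
    fun k w t => (lift_semiconj_line (R' k) (T' k) ψ Set.univ (by simp)
      (fun g t _ => hR' k g t) w t trivial).2
  have hRw' : ∀ w t, ψ (FreeGroup.lift R w t) = FreeGroup.lift T w (ψ t) :=
    fun w t => (lift_semiconj_line R T ψ Set.univ (by simp)
      (fun g t _ => (hT1 g t).symm) w t trivial).2
  choose u hu using fun k => exists_rep_of_tuple
    (fun g => HomeoPlusReal.ofOrderIso (R' k g)) (by
      rw [lift_comp_hom]
      have : FreeGroup.lift (R' k) (surfaceRelator (n + 2)) = 1 := by
        ext t
        apply hψ.injective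
        rw [hR'w, r]; rfl
      rw [this, map_one])
  obtain ⟨k, hk⟩ := exists_mem_of_tendsto ρ hU u fun w => by
    have hunif := TendstoUniformly.lift_freeGroup (X := ℝ) T' T
      (fun g => uniformContinuous_of_eq_outside (hTout g))
      (fun g => uniformContinuous_of_eq_outside (inv_eq_outside (hTout g)))
      (fun g => by
        rw [Metric.tendstoUniformly_iff]
        intro ε hε
        filter_upwards [(tendsto_one_div_add_atTop_nhds_zero_nat (𝕜 := ℝ)).eventually_lt_const hε]
          with k hk y
        rw [dist_comm, Real.dist_eq, orderIso_smul_def, orderIso_smul_def]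
        by_cases hy : 0 ≤ y ∧ y ≤ 1
        · exact (c k g y hy.1 hy.2).trans hk
        · have : y ≤ 0 ∨ 1 ≤ y := by
            rw [not_and_or, not_le, not_le] at hy
            exact hy.imp le_of_lt le_of_lt
          rw [s k g y this, hTout g y this]; simpa using hε) w
    -- As `ψ` is an embedding, compact-open convergence can be tested after composing with `ψ`,
    -- where it is even uniform.
    rw [(ContinuousMap.isInducing_postcomp ⟨ψ, hψc⟩ hψe.isInducing).tendsto_nhds_iff,
      ContinuousMap.tendsto_iff_tendstoLocallyUniformly]
    have h2 := (hunif.comp ψ).tendstoLocallyUniformly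
    convert h2 using 1
    · ext k t
      change ψ (((u k).hom (PresentedGroup.mk _ w) : ℝ ≃ₜ ℝ) t) = FreeGroup.lift (T' k) w (ψ t)
      rw [← hR'w, hu, lift_comp_hom]; rfl
    · ext t
      change ψ ((ρ.hom (PresentedGroup.mk _ w) : ℝ ≃ₜ ℝ) t) = FreeGroup.lift T w (ψ t)
      rw [← hRw', hRw]; rfl
  refine ⟨u k, hk, Set.eq_empty_iff_forall_notMem.2 fun t ht => ?_⟩
  have hin : ψ t ∈ Set.Ioo (0 : ℝ) 1 := by rw [← hran]; exact ⟨t, rfl⟩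
  obtain ⟨g, hg⟩ := nf k (ψ t) hin.1 hin.2
  apply hg
  rw [← hR']
  congr 1
  have h1 : ((u k).hom (PresentedGroup.mk _ (FreeGroup.of g)) : ℝ ≃ₜ ℝ) t = t := ht _
  rwa [hu, FreeGroup.lift_apply_of, HomeoPlusReal.ofOrderIso_apply] at h1

/-! ### The circle -/

theorem exists_orderIso_periodize (f : ℝ ≃o ℝ) (h0 : f 0 = 0) (h1 : f 1 = 1) :
    ∃ P : ℝ ≃o ℝ, (∀ y (m : ℤ), P (y + m) = P y + m) ∧ ∀ y, 0 ≤ y → y ≤ 1 → P y = f y := by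
  have hf : ∀ y, f (Int.fract y) < 1 ∧ 0 ≤ f (Int.fract y) := fun y => by
    constructor
    · rw [← h1]; exact f.strictMono (Int.fract_lt_one y)
    · rw [← h0]; exact f.monotone (Int.fract_nonneg y)
  have hmono : StrictMono fun y : ℝ => (⌊y⌋ : ℝ) + f (Int.fract y) := by
    intro y z hyz
    dsimp only
    rcases (Int.floor_mono hyz.le).eq_or_lt with h | h
    · rw [h]
      have : Int.fract y < Int.fract z := by
        rw [Int.fract, Int.fract, h]; linarith
      have := f.strictMono this
      linarith
    · have h2 : (⌊y⌋ : ℝ) + 1 ≤ ⌊z⌋ := by exact_mod_cast h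
      have := (hf y).1
      have := (hf z).2
      linarith
  have hint : ∀ (s : ℝ) (m : ℤ), 0 ≤ s → s < 1 → (⌊s + m⌋ : ℝ) + f (Int.fract (s + m)) = f s + m := by
    intro s m hs hs'
    have h2 : ⌊s⌋ = 0 := Int.floor_eq_zero_iff.2 ⟨hs, hs'⟩
    rw [Int.floor_add_intCast, Int.fract_add_intCast, h2, Int.fract_eq_self.2 ⟨hs, hs'⟩]
    push_cast; ring
  have hsurj : Function.Surjective fun y : ℝ => (⌊y⌋ : ℝ) + f (Int.fract y) := by
    intro t
    refine ⟨f.symm (Int.fract t) + ⌊t⌋, ?_⟩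
    dsimp only
    rw [hint]
    · rw [f.apply_symm_apply]; exact Int.fract_add_floor t
    · rw [f.le_symm_apply, h0]; exact Int.fract_nonneg t
    · rw [f.symm_apply_lt, h1]; exact Int.fract_lt_one t
  refine ⟨hmono.orderIsoOfSurjective _ hsurj, fun y m => ?_, fun y hy hy' => ?_⟩
  · simp only [StrictMono.coe_orderIsoOfSurjective]
    rw [Int.floor_add_intCast, Int.fract_add_intCast]; push_cast; ring
  · simp only [StrictMono.coe_orderIsoOfSurjective]
    rcases hy'.eq_or_lt with rfl | hy'
    · simp [h0, h1]
    · have := hint y 0 hy hy'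
      simpa using this

theorem exists_periodic_bump {η : ℝ} (hη : 0 < η) : ∃ f : ℝ ≃o ℝ,
    (∀ y (m : ℤ), f (y + m) = f y + m) ∧ (∀ y : ℝ, ‖(y : UnitAddCircle)‖ < η → y < f y) ∧
      (∀ y : ℝ, η ≤ ‖(y : UnitAddCircle)‖ → f y = y) ∧ ∀ y : ℝ, |f y - y| ≤ η / 2 := by
  have hmono : StrictMono fun y : ℝ => y + max 0 (η - ‖(y : UnitAddCircle)‖) / 2 := by
    intro y z hyz
    have h1 : max 0 (η - ‖(y : UnitAddCircle)‖) ≤ max 0 (η - ‖(z : UnitAddCircle)‖) + (z - y) := by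
      refine max_le (by have := le_max_left 0 (η - ‖(z : UnitAddCircle)‖); linarith) ?_
      have h2 := le_max_right 0 (η - ‖(z : UnitAddCircle)‖)
      have h3 : ‖(z : UnitAddCircle)‖ ≤ ‖(y : UnitAddCircle)‖ + |z - y| := by
        rw [UnitAddCircle.norm_eq, UnitAddCircle.norm_eq]
        have h4 := round_le z (round y)
        have h5 := abs_add_le (y - round y) (z - y)
        rw [show y - round y + (z - y) = z - round y by ring] at h5
        linarith
      rw [abs_of_pos (by linarith : 0 < z - y)] at h3
      linarith
    dsimp only; linarith
  have hnonneg : ∀ y : ℝ, 0 ≤ max 0 (η - ‖(y : UnitAddCircle)‖) / 2 := fun y => by positivity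
  have hle : ∀ y : ℝ, max 0 (η - ‖(y : UnitAddCircle)‖) ≤ η := fun y =>
    max_le hη.le (by have := norm_nonneg (y : UnitAddCircle); linarith)
  have hcont : Continuous fun y : ℝ => (y : UnitAddCircle) := AddCircle.continuous_mk' 1
  have hsurj : Function.Surjective fun y : ℝ => y + max 0 (η - ‖(y : UnitAddCircle)‖) / 2 := by
    refine Continuous.surjective (by fun_prop) ?_ ?_
    · exact Filter.tendsto_atTop_mono (fun y => by have := hnonneg y; simp only [id]; linarith)
        Filter.tendsto_id
    · refine Filter.tendsto_atBot_mono (f := fun y => y + η / 2) (fun y => ?_)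
        (Filter.tendsto_atBot_add_const_right _ _ Filter.tendsto_id)
      have := hle y
      linarith
  refine ⟨hmono.orderIsoOfSurjective _ hsurj, fun y m => ?_, fun y hy => ?_, fun y hy => ?_,
    fun y => ?_⟩ <;> simp only [StrictMono.coe_orderIsoOfSurjective]
  · have : ((y + m : ℝ) : UnitAddCircle) = y := by
      rw [AddCircle.coe_add, add_eq_left, AddCircle.coe_eq_zero_iff]
      exact ⟨m, by simp⟩
    rw [this]; ring
  · rw [max_eq_right (by linarith)]; linarith
  · rw [max_eq_left (by linarith)]; simp
  · rw [add_sub_cancel_left, abs_of_nonneg (hnonneg y)]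
    have := hle y
    linarith

theorem unitAddCircle_coe_eq_iff {y z : ℝ} :
    (y : UnitAddCircle) = z ↔ ∃ m : ℤ, y = z + m := by
  rw [← sub_eq_zero, ← AddCircle.coe_sub, AddCircle.coe_eq_zero_iff]
  constructor
  · rintro ⟨m, hm⟩; exact ⟨m, by simp at hm; linarith⟩
  · rintro ⟨m, hm⟩; exact ⟨m, by simp; linarith⟩

theorem unitAddCircle_coe_inj {y z : ℝ} (hy : 0 ≤ y) (hy' : y < 1) (hz : 0 ≤ z) (hz' : z < 1)
    (h : (y : UnitAddCircle) = z) : y = z := by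
  obtain ⟨m, hm⟩ := unitAddCircle_coe_eq_iff.1 h
  have h1 : (m : ℝ) < 1 := by linarith
  have h2 : (-1 : ℝ) < m := by linarith
  have h3 : m < 1 := by exact_mod_cast h1
  have h4 : -1 < m := by exact_mod_cast h2
  have : m = 0 := by omega
  simpa [this] using hm

theorem exists_circleMap (F : ℝ ≃o ℝ) (hF : ∀ y, F (y + 1) = F y + 1) :
    ∃ e : UnitAddCircle → UnitAddCircle, Continuous e ∧ ∀ y : ℝ, e y = F y := by
  have hper : Function.Periodic (fun y => (F y : UnitAddCircle)) 1 := fun y => by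
    dsimp only; rw [hF]; exact AddCircle.coe_add_period 1 _
  refine ⟨hper.lift, ?_, fun y => rfl⟩
  have : Continuous fun y : ℝ => (F y : UnitAddCircle) :=
    (AddCircle.continuous_mk' 1).comp F.continuous
  exact this.quotient_lift _

theorem exists_homeoPlusCircle (Q : ℝ ≃o ℝ) (hQ : ∀ y, Q (y + 1) = Q y + 1) (θ : ℝ) :
    ∃ E : HomeoPlusCircle, ∀ y : ℝ, (E : UnitAddCircle ≃ₜ UnitAddCircle) ((y + θ : ℝ)) =
      ((Q y + θ : ℝ) : UnitAddCircle) := by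
  set L := affineIso 0 θ 1 one_pos with hL
  have hLa : ∀ y, L y = y + θ := fun y => by simp [hL]; ring
  have hLs : ∀ y, L⁻¹ y = y - θ := fun y => by
    apply L.injective; rw [RelIso.apply_inv_self, hLa]; ring
  set F := L * Q * L⁻¹ with hF
  have hFa : ∀ y, F y = Q (y - θ) + θ := fun y => by
    simp only [hF, RelIso.mul_apply]; rw [hLs, hLa]
  have hF1 : ∀ y, F (y + 1) = F y + 1 := fun y => by
    rw [hFa, hFa, show y + 1 - θ = y - θ + 1 by ring, hQ]; ring
  have hF2 : ∀ y, F⁻¹ (y + 1) = F⁻¹ y + 1 := fun y => by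
    apply F.injective
    rw [RelIso.apply_inv_self, hF1, RelIso.apply_inv_self]
  obtain ⟨e, he, hee⟩ := exists_circleMap F hF1
  obtain ⟨e', he', hee'⟩ := exists_circleMap F⁻¹ hF2
  let E : UnitAddCircle ≃ₜ UnitAddCircle :=
    { toFun := e
      invFun := e'
      left_inv := fun x => by
        induction x using QuotientAddGroup.induction_on with
        | H y =>
          rw [hee, hee', RelIso.inv_apply_self]
      right_inv := fun x => by
        induction x using QuotientAddGroup.induction_on with
        | H y =>
          rw [hee', hee, RelIso.apply_inv_self]
      continuous_toFun := he
      continuous_invFun := he' }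
  refine ⟨⟨E, F.toHomeomorph, F.strictMono, hee⟩, fun y => ?_⟩
  refine (hee _).trans ?_
  rw [hFa, add_sub_cancel_right]

/-- In the coordinate centred at `θ`, the lift is normalised to fix `0`. Then `K 1` is a positive
integer, and if it exceeded `1` the point `K⁻¹ 1` in `(0, 1)` would give a second preimage of `θ` on
the circle. -/
theorem exists_lift_fixing (f : HomeoPlusCircle) (θ : ℝ)
    (hf : (f : UnitAddCircle ≃ₜ UnitAddCircle) (θ : UnitAddCircle) = (θ : UnitAddCircle)) :
    ∃ K : ℝ ≃o ℝ, K 0 = 0 ∧ K 1 = 1 ∧ ∀ y : ℝ,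
      (f : UnitAddCircle ≃ₜ UnitAddCircle) ((y + θ : ℝ)) = ((K y + θ : ℝ) : UnitAddCircle) := by
  obtain ⟨F, hF, hfF⟩ := f.2
  set F' := HomeoPlusReal.toOrderIso ⟨F, hF⟩ with hF'
  have hfF' : ∀ y : ℝ, (f : UnitAddCircle ≃ₜ UnitAddCircle) y = (F' y : UnitAddCircle) := hfF
  obtain ⟨m, hm⟩ := unitAddCircle_coe_eq_iff.1 ((hfF' θ).symm.trans hf)
  set K := affineIso 0 (-θ - m) 1 one_pos * F' * affineIso 0 θ 1 one_pos with hK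
  have hKa : ∀ y, K y = F' (y + θ) - θ - m := fun y => by
    simp only [hK, RelIso.mul_apply, affineIso_apply]
    rw [show θ + 1 * (y - 0) = y + θ by ring]; ring
  have hfK : ∀ y : ℝ, (f : UnitAddCircle ≃ₜ UnitAddCircle) ((y + θ : ℝ)) =
      ((K y + θ : ℝ) : UnitAddCircle) := fun y => by
    rw [hfF', unitAddCircle_coe_eq_iff]
    exact ⟨m, by rw [hKa]; ring⟩
  have hK0 : K 0 = 0 := by rw [hKa, zero_add, hm]; ring
  refine ⟨K, hK0, ?_, hfK⟩
  have h1θ : ((1 + θ : ℝ) : UnitAddCircle) = (θ : UnitAddCircle) :=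
    unitAddCircle_coe_eq_iff.2 ⟨1, by push_cast; ring⟩
  have h1 := hfK 1
  rw [h1θ, hf] at h1
  obtain ⟨j, hj⟩ := unitAddCircle_coe_eq_iff.1 h1
  have h2 : 0 < K 1 := by rw [← hK0]; exact K.strictMono one_pos
  have h3 : 1 ≤ K 1 := by
    have e : K 1 = ((-j : ℤ) : ℝ) := by push_cast; linarith
    rw [e] at h2 ⊢
    have : 0 < -j := by exact_mod_cast h2
    exact_mod_cast this
  by_contra hne
  have h4 : 1 < K 1 := lt_of_le_of_ne h3 (Ne.symm hne)
  have h5 : K.symm 1 < 1 := by rwa [K.symm_apply_lt]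
  have h6 : 0 < K.symm 1 := by rw [K.lt_symm_apply, hK0]; exact one_pos
  have h7 := hfK (K.symm 1)
  rw [K.apply_symm_apply, h1θ, ← hf] at h7
  have h8 := (f : UnitAddCircle ≃ₜ UnitAddCircle).injective h7
  have h9 : ((K.symm 1 : ℝ) : UnitAddCircle) = ((0 : ℝ) : UnitAddCircle) := by
    obtain ⟨i, hi⟩ := unitAddCircle_coe_eq_iff.1 h8
    exact unitAddCircle_coe_eq_iff.2 ⟨i, by linarith⟩
  exact h6.ne' (unitAddCircle_coe_inj h6.le h5 le_rfl one_pos h9)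

instance homeomorphMulAction {X : Type*} [TopologicalSpace X] : MulAction (X ≃ₜ X) X where
  smul f x := f x
  one_smul _ := rfl
  mul_smul _ _ _ := rfl

/-- On the invariant fundamental domain `[0, 1)` the words in `P` and `T` agree, and `P` commutes
with integer translations. -/
theorem lift_eq_one_of_periodic {ι : Type*} {P T : ι → ℝ ≃o ℝ} {w : FreeGroup ι}
    (hT : FreeGroup.lift T w = 1) (h0 : ∀ g, T g 0 = 0) (h1 : ∀ g, T g 1 = 1)
    (hP : ∀ g y (m : ℤ), P g (y + m) = P g y + m) (hPT : ∀ g y, 0 ≤ y → y ≤ 1 → P g y = T g y) :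
    FreeGroup.lift P w = 1 := by
  have hmem : ∀ g y, P g y ∈ Set.Ico (0 : ℝ) 1 ↔ y ∈ Set.Ico (0 : ℝ) 1 := fun g y => by
    have e0 : P g 0 = 0 := by rw [hPT g 0 le_rfl zero_le_one, h0]
    have e1 : P g 1 = 1 := by rw [hPT g 1 zero_le_one le_rfl, h1]
    simp only [Set.mem_Ico]
    nth_rw 1 [← e0, ← e1]
    rw [(P g).lt_iff_lt, (P g).le_iff_le]
  ext y
  have e1 := (lift_semiconj_line P P (fun t => t + (⌊y⌋ : ℤ)) Set.univ (by simp)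
    (fun g t _ => (hP g t _).symm) w (Int.fract y) trivial).2
  have e2 := (lift_semiconj_line P T id (Set.Ico 0 1) hmem
    (fun g t ht => hPT g t ht.1 ht.2.le) w (Int.fract y)
    ⟨Int.fract_nonneg y, Int.fract_lt_one y⟩).2
  rw [hT] at e2
  simp only [id, RelIso.one_apply] at e2
  simp only [e2, Int.fract_add_floor] at e1
  exact e1.symm

theorem lt_or_lt_of_norm_coe_lt {y : ℝ} (h0 : 0 < y) (h1 : y < 1) {η : ℝ}
    (h : ‖(y : UnitAddCircle)‖ < η) : y < η ∨ 1 - η < y := by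
  rw [UnitAddCircle.norm_eq, abs_lt] at h
  have h2 := abs_le.1 (abs_sub_round y)
  have h3 : (-1 : ℝ) < round y := by linarith
  have h4 : (round y : ℝ) < 2 := by linarith
  have h5 : -1 < round y := by exact_mod_cast h3
  have h6 : round y < 2 := by exact_mod_cast h4
  obtain h7 | h7 : round y = 0 ∨ round y = 1 := by omega
  · left; rw [h7] at h; push_cast at h; linarith
  · right; rw [h7] at h; push_cast at h; linarith

/-- After periodizing, the integers are the only common fixed points left. The end condition of
`ApproxOn` at `0` and at `1` supplies both sides of this point of the circle, so the bump trick
applies, now with a periodic bump. Excluding every `y + m` expresses that the point is moved on the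
circle and not merely on the line. -/
theorem exists_periodic_approx {n : ℕ} {T R : SurfaceGen n → ℝ ≃o ℝ}
    (hT : FreeGroup.lift T (surfaceRelator (n + 2)) = 1) (h0 : ∀ g, T g 0 = 0)
    (h1 : ∀ g, T g 1 = 1) (hR : ∀ g y (m : ℤ), R g (y + m) = R g y + m)
    (hRT : ∀ g y, 0 ≤ y → y ≤ 1 → R g y = T g y) {ε : ℝ} (hε : 0 < ε) :
    ∃ Q : SurfaceGen n → ℝ ≃o ℝ, FreeGroup.lift Q (surfaceRelator (n + 2)) = 1 ∧
      (∀ g y (m : ℤ), Q g (y + m) = Q g y + m) ∧ (∀ g y, |Q g y - R g y| < ε) ∧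
      ∀ y, 0 ≤ y → y < 1 → ∃ g, ∀ m : ℤ, Q g y ≠ y + m := by
  classical
  obtain ⟨T', r, s, c, nf, η₀, hη₀, hend⟩ := approxOn_of_fixed T hT hε zero_lt_one h0 h1
  have s0 : ∀ g, T' g 0 = 0 := fun g => s g 0 (Or.inl le_rfl)
  have s1 : ∀ g, T' g 1 = 1 := fun g => s g 1 (Or.inr le_rfl)
  choose P hP hPT using fun g => exists_orderIso_periodize (T' g) (s0 g) (s1 g)
  have hP0 : ∀ g, P g 0 = 0 := fun g => by rw [hPT g 0 le_rfl zero_le_one, s0]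
  have hP1 : ∀ g, P g 1 = 1 := fun g => by rw [hPT g 1 zero_le_one le_rfl, s1]
  have hR0 : ∀ g, R g 0 = 0 := fun g => by rw [hRT g 0 le_rfl zero_le_one, h0]
  obtain ⟨η₁, hη₁, hc⟩ : ∃ η > 0, ∀ y, |y| < η →
      |P (Sum.inl 0) y| < ε / 2 ∧ |R (Sum.inl 0) y| < ε / 2 := by
    obtain ⟨δ, hδ, hδ'⟩ := Metric.continuousAt_iff.1
      ((P (Sum.inl 0)).continuous.continuousAt (x := 0)) (ε / 2) (by linarith)
    obtain ⟨δ', hδ1, hδ2⟩ := Metric.continuousAt_iff.1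
      ((R (Sum.inl 0)).continuous.continuousAt (x := 0)) (ε / 2) (by linarith)
    simp only [hP0, hR0, dist_zero_right, Real.norm_eq_abs] at hδ' hδ2
    exact ⟨min δ δ', lt_min hδ hδ1, fun y hy => ⟨hδ' (hy.trans_le (min_le_left _ _)),
      hδ2 (hy.trans_le (min_le_right _ _))⟩⟩
  -- The bump displaces by at most `η / 2`, so `η < η₁ / 2` keeps displaced points within the range
  -- controlled by `η₁`.
  obtain ⟨η, hη, hη'⟩ : ∃ η > 0, η < η₀ ∧ η < η₁ / 2 ∧ η < 1 / 2 := by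
    have : 0 < min η₀ (min (η₁ / 2) (1 / 2)) := by
      simp only [lt_min_iff]
      exact ⟨hη₀, by linarith, by norm_num⟩
    obtain ⟨η, h1, h2⟩ := exists_between this
    simp only [lt_min_iff] at h2
    exact ⟨η, h1, h2⟩
  obtain ⟨k0, k1, k2⟩ := hη'
  obtain ⟨f, hf1, hf2, hf3, hf4⟩ := exists_periodic_bump hη
  have hfne : ∀ y : ℝ, f y ≠ y → ‖(y : UnitAddCircle)‖ < η := fun y hy => by
    by_contra! h; exact hy (hf3 y h)
  have hrelP : FreeGroup.lift P (surfaceRelator (n + 2)) = 1 :=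
    lift_eq_one_of_periodic r s0 s1 hP hPT
  have hcomm : f * P (Sum.inr 0) = P (Sum.inr 0) * f :=
    commute_of_disjoint_support fun y hy => by
      have h2 := hfne y hy
      have h3 : P (Sum.inr 0) (Int.fract y) = Int.fract y := by
        rcases (Int.fract_nonneg y).eq_or_lt with h | h
        · rw [← h, hP0]
        · have h4 : ‖((Int.fract y : ℝ) : UnitAddCircle)‖ < η := by
            convert h2 using 2
            exact unitAddCircle_coe_eq_iff.2 ⟨-⌊y⌋, by
              push_cast; rw [Int.fract]; ring⟩
          rw [hPT _ _ h.le (Int.fract_lt_one y).le]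
          refine (hend _ h (Int.fract_lt_one y) ?_).1
          rcases lt_or_lt_of_norm_coe_lt h (Int.fract_lt_one y) h4 with h5 | h5
          · left; linarith
          · right; linarith
      rw [← Int.fract_add_floor y, hP, h3]
  set Q := Function.update P (Sum.inl 0) (P (Sum.inl 0) * f) with hQ
  have t1 : ∀ g, g ≠ Sum.inl 0 → Q g = P g := fun g hg => Function.update_of_ne hg _ _
  have t2 : Q (Sum.inl 0) = P (Sum.inl 0) * f := Function.update_self ..
  have t3 : ∀ g (y : ℝ), η ≤ ‖(y : UnitAddCircle)‖ → Q g y = P g y := by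
    intro g y hy
    by_cases hg : g = Sum.inl 0
    · rw [hg, t2, RelIso.mul_apply, hf3 y hy]
    · rw [t1 g hg]
  have closeP : ∀ g y, |P g y - R g y| < ε := by
    intro g y
    rw [← Int.fract_add_floor y, hP, hR, add_sub_add_right_eq_sub,
      hPT g _ (Int.fract_nonneg y) (Int.fract_lt_one y).le,
      hRT g _ (Int.fract_nonneg y) (Int.fract_lt_one y).le]
    exact c g _ (Int.fract_nonneg y) (Int.fract_lt_one y).le
  have hmove : ∀ g y, 0 < y → y < 1 → P g y ≠ y → ∀ m : ℤ, P g y ≠ y + m := by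
    intro g y hy hy' hne m hm
    apply hne
    refine unitAddCircle_coe_inj ?_ ?_ hy.le hy' (unitAddCircle_coe_eq_iff.2 ⟨m, hm⟩)
    · rw [← hP0 g]; exact (P g).monotone hy.le
    · rw [← hP1 g]; exact (P g).strictMono hy'
  refine ⟨Q, lift_update_eq_one P hrelP f hcomm, fun g y m => ?_, fun g y => ?_,
    fun y hy hy' => ?_⟩
  · by_cases hg : g = Sum.inl 0
    · rw [hg, t2, RelIso.mul_apply, RelIso.mul_apply, hf1, hP]
    · rw [t1 g hg, hP]
  · by_cases hg : g = Sum.inl 0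
    · rcases lt_or_ge ‖(y : UnitAddCircle)‖ η with hy | hy
      · rw [UnitAddCircle.norm_eq] at hy
        set t := y - round y with ht
        have hyt : y = t + round y := by rw [ht]; ring
        rw [hyt, hg, t2, RelIso.mul_apply, hf1, hP, hR, add_sub_add_right_eq_sub]
        have h4 := hf4 t
        have e1 := (hc t (by linarith)).2
        have e2 := (hc (f t) (by
          rw [abs_le] at h4; rw [abs_lt] at hy ⊢
          constructor <;> linarith)).1
        rw [abs_lt] at e1 e2 ⊢
        constructor <;> linarith
      · rw [t3 g y hy]; exact closeP g y
    · rw [t1 g hg]; exact closeP g y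
  · rcases hy.eq_or_lt with rfl | hy
    · refine ⟨Sum.inl 0, fun m hm => ?_⟩
      have e1 : 0 < f 0 := hf2 0 (by simpa using hη)
      have e2 : f 0 < 1 := by
        have := (abs_le.1 (hf4 0)).2
        linarith
      rw [t2, RelIso.mul_apply] at hm
      have e3 : 0 < P (Sum.inl 0) (f 0) := by
        nth_rw 1 [← hP0 (Sum.inl 0)]; exact (P _).strictMono e1
      have e4 : P (Sum.inl 0) (f 0) < 1 := by
        rw [← hP1 (Sum.inl 0)]; exact (P _).strictMono e2
      exact e3.ne' (unitAddCircle_coe_inj e3.le e4 le_rfl one_pos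
        (unitAddCircle_coe_eq_iff.2 ⟨m, hm⟩))
    · rcases lt_or_ge ‖(y : UnitAddCircle)‖ η with h | h
      · refine ⟨Sum.inl 1, ?_⟩
        rw [t1 _ (by simp)]
        refine hmove _ y hy hy' ?_
        rw [hPT _ y hy.le hy'.le]
        refine (hend y hy hy' ?_).2
        rcases lt_or_lt_of_norm_coe_lt hy hy' h with h5 | h5
        · left; linarith
        · right; linarith
      · obtain ⟨g, hg⟩ := nf y hy hy'
        refine ⟨g, ?_⟩
        rw [t3 g y h]
        exact hmove g y hy hy' (by rwa [hPT _ y hy.le hy'.le])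

/-- Only a representation with a global fixed point `θ` needs perturbing. Cutting at `θ` turns the
action into one on `[0, 1]`, extended by the identity to the line. -/
theorem exists_mem_globalFix_eq_empty_circle {n : ℕ}
    (ρ : HomeoRep (SurfaceGroup (n + 2)) HomeoPlusCircle) {U} (hU : U ∈ 𝓝 ρ) :
    ∃ ρ' ∈ U, ρ'.globalFix = ∅ := by
  rcases Set.eq_empty_or_nonempty ρ.globalFix with h | ⟨x, hx⟩
  · exact ⟨ρ, mem_of_mem_nhds hU, h⟩
  obtain ⟨θ, rfl⟩ := QuotientAddGroup.mk_surjective x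
  set f : SurfaceGen n → HomeoPlusCircle := fun g => ρ.hom (PresentedGroup.of g) with hf
  choose K hK0 hK1 hK using fun g => exists_lift_fixing (f g) θ (hx _)
  have hT : ∀ g, ∃ T : ℝ ≃o ℝ, (∀ y, 0 ≤ y → y ≤ 1 → T y = K g y) ∧
      ∀ y, y ≤ 0 ∨ 1 ≤ y → T y = y := fun g => by
    obtain ⟨k, hk, hk'⟩ := exists_orderIso_glue 1 (K g) 1 (hK1 g)
    obtain ⟨T, hT, hT'⟩ := exists_orderIso_glue 0 1 k (by rw [hk 0 zero_le_one, hK0]; rfl)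
    refine ⟨T, fun y h0 h1 => by rw [hT' y h0, hk y h1], fun y hy => ?_⟩
    rcases hy with hy | hy
    · exact hT y hy
    · rw [hT' y (zero_le_one.trans hy), hk' y hy]; rfl
  choose T hTK hTout using hT
  have hT0 : ∀ g, T g 0 = 0 := fun g => hTout g 0 (Or.inl le_rfl)
  have hT1 : ∀ g, T g 1 = 1 := fun g => hTout g 1 (Or.inr le_rfl)
  have hTrel : FreeGroup.lift T (surfaceRelator (n + 2)) = 1 := by
    ext y
    by_cases hy : y ∈ Set.Ioo (0 : ℝ) 1
    -- The relator holds on the circle, so it moves `y` by an integer; staying in `(0, 1)` forces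
    -- that integer to be zero.
    · obtain ⟨e1, e2⟩ := freeGroup_lift_semiconj T f
        (fun y : ℝ => ((y + θ : ℝ) : UnitAddCircle)) (Set.Ioo 0 1)
        (fun g t => by
          rw [orderIso_smul_def]
          simp only [Set.mem_Ioo]
          nth_rw 1 [← hT0 g, ← hT1 g]
          rw [(T g).lt_iff_lt, (T g).lt_iff_lt])
        (fun g t ht => by
          rw [orderIso_smul_def, hTK g t ht.1.le ht.2.le]
          exact (hK g t).symm) (surfaceRelator (n + 2)) y hy
      rw [HomeoRep.lift_relator, one_smul] at e2
      obtain ⟨m, hm⟩ := unitAddCircle_coe_eq_iff.1 e2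
      change FreeGroup.lift T (surfaceRelator (n + 2)) y = y
      exact unitAddCircle_coe_inj e1.1.le e1.2 hy.1.le hy.2
        (unitAddCircle_coe_eq_iff.2 ⟨m, by rw [orderIso_smul_def] at hm; linarith⟩)
    · rw [Set.mem_Ioo, not_and_or, not_lt, not_lt] at hy
      exact lift_apply_eq_self T y (fun g => hTout g y hy) _
  choose R hR hRT using fun g => exists_orderIso_periodize (T g) (hT0 g) (hT1 g)
  have hfR : ∀ g (y : ℝ), f g • ((y + θ : ℝ) : UnitAddCircle) = ((R g y + θ : ℝ)) := by
    intro g y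
    have h1 : ((y + θ : ℝ) : UnitAddCircle) = ((Int.fract y + θ : ℝ)) :=
      unitAddCircle_coe_eq_iff.2 ⟨⌊y⌋, by rw [Int.fract]; ring⟩
    rw [h1]
    refine (hK g _).trans ?_
    rw [← hTK g _ (Int.fract_nonneg y) (Int.fract_lt_one y).le,
      ← hRT g _ (Int.fract_nonneg y) (Int.fract_lt_one y).le]
    refine unitAddCircle_coe_eq_iff.2 ⟨-⌊y⌋, ?_⟩
    nth_rw 2 [← Int.fract_add_floor y]
    rw [hR]; push_cast
    ring
  have hsurj : ∀ x : UnitAddCircle, ∃ y : ℝ, ((y + θ : ℝ) : UnitAddCircle) = x := fun x => by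
    obtain ⟨z, rfl⟩ := QuotientAddGroup.mk_surjective x
    exact ⟨z - θ, by rw [sub_add_cancel]⟩
  choose Q r p c nf using fun k : ℕ => exists_periodic_approx hTrel hT0 hT1 hR hRT
    (Nat.one_div_pos_of_nat (α := ℝ) (n := k))
  choose E hE using fun k g => exists_homeoPlusCircle (Q k g)
    (fun y => by simpa using p k g y 1) θ
  have hErel : ∀ k, FreeGroup.lift (E k) (surfaceRelator (n + 2)) = 1 := by
    intro k
    ext x
    obtain ⟨y, rfl⟩ := hsurj x
    have e2 := (freeGroup_lift_semiconj (Q k) (E k)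
      (fun y : ℝ => ((y + θ : ℝ) : UnitAddCircle)) Set.univ (by simp)
      (fun g t _ => (hE k g t).symm) (surfaceRelator (n + 2)) y trivial).2
    rw [r k, one_smul] at e2
    exact e2.symm
  choose u hu using fun k => exists_rep_of_tuple (E k) (hErel k)
  obtain ⟨k, hk⟩ := exists_mem_of_tendsto ρ hU u fun w => by
    have hunif := TendstoUniformly.lift_freeGroup (X := UnitAddCircle) E f
      (fun g => CompactSpace.uniformContinuous_of_continuous (f g).1.continuous)
      (fun g => CompactSpace.uniformContinuous_of_continuous (f g).1.symm.continuous)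
      (fun g => by
        rw [Metric.tendstoUniformly_iff]
        intro ε hε
        filter_upwards [(tendsto_one_div_add_atTop_nhds_zero_nat (𝕜 := ℝ)).eventually_lt_const hε]
          with k hk x
        obtain ⟨y, rfl⟩ := hsurj x
        rw [hfR, show E k g • ((y + θ : ℝ) : UnitAddCircle) = ((Q k g y + θ : ℝ)) from hE k g y,
          dist_eq_norm, ← AddCircle.coe_sub, add_sub_add_right_eq_sub]
        refine lt_of_le_of_lt ?_ ((c k g y).trans hk)
        rw [UnitAddCircle.norm_eq, abs_sub_comm (Q k g y)]
        simpa using round_le (R g y - Q k g y) 0) w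
    rw [ContinuousMap.tendsto_iff_tendstoUniformly]
    convert hunif using 1
    · ext k x
      rw [hu]; rfl
    · ext x
      rw [HomeoRep.hom_mk]; rfl
  refine ⟨u k, hk, Set.eq_empty_iff_forall_notMem.2 fun x hx => ?_⟩
  obtain ⟨z, rfl⟩ := hsurj x
  have h1 : ((z + θ : ℝ) : UnitAddCircle) = ((Int.fract z + θ : ℝ)) :=
    unitAddCircle_coe_eq_iff.2 ⟨⌊z⌋, by rw [Int.fract]; ring⟩
  rw [h1] at hx
  obtain ⟨g, hg⟩ := nf k (Int.fract z) (Int.fract_nonneg z) (Int.fract_lt_one z)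
  have h2 : ((u k).hom (PresentedGroup.mk _ (FreeGroup.of g)) : UnitAddCircle ≃ₜ UnitAddCircle)
    ((Int.fract z + θ : ℝ)) = ((Int.fract z + θ : ℝ) : UnitAddCircle) := hx _
  rw [hu, FreeGroup.lift_apply_of, hE] at h2
  obtain ⟨m, hm⟩ := unitAddCircle_coe_eq_iff.1 h2
  exact hg m (by linarith)

theorem mainTheorem3 (q : ℕ) (hq : 2 ≤ q) :
    (∀ (ρ : HomeoRep (SurfaceGroup q) HomeoPlusReal), ∀ U ∈ 𝓝 ρ, ∃ ρ' ∈ U, ρ'.globalFix = ∅) ∧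
    (∀ (ρ : HomeoRep (SurfaceGroup q) HomeoPlusCircle), ∀ U ∈ 𝓝 ρ, ∃ ρ' ∈ U, ρ'.globalFix = ∅) := by
  obtain ⟨n, rfl⟩ := Nat.exists_eq_add_of_le' hq
  exact ⟨fun ρ _ hU => exists_mem_globalFix_eq_empty_real ρ hU,
    fun ρ _ hU => exists_mem_globalFix_eq_empty_circle ρ hU⟩
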